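/- **Setting.** Let $T>0$, $d\ge 1$, $p\ge 0$, and let $(\Omega,\mathcal F,P)$ be a probability space. A model $\mathbf M=(\Omega,\mathcal F,\mathbb F,P,Y,S)$ consists of an $\mathbb R^p$-valued process $Y=(Y_t)_{t\in[0,T]}$ with RCLL paths, the filtration $\mathbb F=(\mathcal F_t)_{t\in[0,T]}$, where $\mathcal F_t$ is generated by $(Y_s)_{s\le t}$ and the $P$-null sets of $\mathcal F$, and an $\mathbb F$-adapted process $S$ with continuous paths and values in $(0,\infty)^d$, such that $S_0=(1,\dots,1)$ and $S^1\equiv 1$. Let $K\subset\mathbb R^d$ be a closed convex cone with $K\cap(-K)=\{0\}$ and $(0,\infty)^d\subset K$, and let $U:K\to\mathbb R\cup\{-\infty\}$ be Borel measurable. A strategy is an adapted RCLL $\mathbb R^d$-valued process $B=(B_t)_{t\in[0,T]}$ all of whose paths are $K$-decreasing, with the convention $B_{0-}=0$; that is, $-(B_t-B_s)\in K$ for all $0\le s\le t\le T$ and $-B_0\in K$. For $x\in K$, the wealth process $V^{x,B}$ is given by $$V^{x,B,j}_t=S^j_t\Big(x^j+\int_{[0,t]}\frac{1}{S^j_s}\,dB^j_s\Big),\qquad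 j=1,\dots,d,$$ where the integral is the Riemann--Stieltjes integral over $(0,t]$ plus the term $B_0^j/S_0^j$ for the mass $B_0$ at time $0$. The strategy $B$ is admissible, $B\in\mathcal A(x)$, if $V^{x,B}_t\in K$ a.s. for every $t\in[0,T]$. The Bellman function is $$u(x,\mathbf M)=\sup_{B\in\mathcal A(x)}E\,U(V^{x,B}_T)\in[-\infty,\infty],$$ where $E Z=E Z^+-E Z^-$, understood as $-\infty$ if $E Z^-=\infty$. Let $\xi$ be a random variable on $(\Omega,\mathcal F,P)$ that is uniformly distributed on $[0,1]$ and independent of the process $Y$. Let $\mathbf N=(\Omega,\mathcal F,\mathbb G,P,Y,S)$ be the model with the same $Y$ and $S$ and the enlarged filtration $\mathcal G_t=\sigma(\mathcal F_t,\xi)$; strategies and the Bellman function $u(x,\mathbf N)$ are defined as above with $\mathbb G$ in place of $\mathbb F$. **Theorem 1.** Assume that $Y$ has independent increments, where by convention $Y_{0-}=0$ and $Y_0$ counts as an increment. Then for every $x\in\operatorname{int}K$ $$u(x,\mathbf M)=u(x,\mathbf N).$$ -/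

import Mathlib

open MeasureTheory ProbabilityTheory Filter Topology Set

noncomputable section

namespace KabanovMarket

/-- A path on an ordered time set is RCLL: right-continuous with left limits. -/
def IsRCLL {ι E : Type*} [Preorder ι] [TopologicalSpace ι] [TopologicalSpace E]
    (f : ι → E) : Prop :=
  ∀ t, ContinuousWithinAt f (Ici t) t ∧ ∃ l, Tendsto f (𝓝[<] t) (𝓝 l)

/-- `I` is the Riemann–Stieltjes integral of `f` against `g` over `(a, b]`: the limit of the
tagged Riemann–Stieltjes sums as the mesh of the partition `a = p 0 ≤ ⋯ ≤ p n = b` tends to `0`.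
It does not include a mass of `dg` at the left end point `a`. -/
def HasRSIntegral {T : ℝ} (f g : Icc (0 : ℝ) T → ℝ) (a b : Icc (0 : ℝ) T) (I : ℝ) : Prop :=
  ∀ ε > 0, ∃ δ > 0, ∀ (n : ℕ) (p τ : ℕ → Icc (0 : ℝ) T),
    Monotone p → p 0 = a → p n = b →
    (∀ i < n, p i ≤ τ i ∧ τ i ≤ p (i + 1)) →
    (∀ i < n, (p (i + 1) : ℝ) - (p i : ℝ) < δ) →
    |∑ i ∈ Finset.range n, f (τ i) * (g (p (i + 1)) - g (p i)) - I| < ε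

open Classical in
/-- The Riemann–Stieltjes integral `∫_{(a, b]} f dg`. It exists whenever `f` is continuous and `g`
is of finite variation; the default value `0` is used when it does not exist. -/
def rsIntegral {T : ℝ} (f g : Icc (0 : ℝ) T → ℝ) (a b : Icc (0 : ℝ) T) : ℝ :=
  if h : ∃ I, HasRSIntegral f g a b I then h.choose else 0

/-- The data `(𝔽, Y, S)` of a model of a market with `d` assets over the probability space
`(Ω, 𝓕, P)` and the time interval `[0, T]`. -/
structure MarketModel {Ω : Type*} [mΩ : MeasurableSpace Ω] (P : Measure Ω)
    (T : ℝ) (p d : ℕ) [NeZero d] where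
  T_pos : 0 < T
  /-- the information flow `(𝓕_t)` -/
  filtration : Filtration (Icc (0 : ℝ) T) mΩ
  /-- the driving process -/
  Y : Icc (0 : ℝ) T → Ω → (Fin p → ℝ)
  Y_adapted : Adapted filtration Y
  Y_rcll : ∀ ω, IsRCLL fun t => Y t ω
  /-- the prices of the assets; the asset with index `0` is the numeraire -/
  S : Icc (0 : ℝ) T → Ω → (Fin d → ℝ)
  S_adapted : Adapted filtration S
  S_continuous : ∀ ω, Continuous fun t => S t ω
  S_pos : ∀ t ω j, 0 < S t ω j
  S_start : ∀ ω, S ⟨0, le_rfl, T_pos.le⟩ ω = 1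
  S_numeraire : ∀ t ω, S t ω 0 = 1

namespace MarketModel

variable {Ω : Type*} [mΩ : MeasurableSpace Ω] {P : Measure Ω} {T : ℝ} {p d : ℕ} [NeZero d]

/-- The initial time `0`. -/
def start (M : MarketModel P T p d) : Icc (0 : ℝ) T := ⟨0, le_rfl, M.T_pos.le⟩

/-- The terminal time `T`. -/
def horizon (M : MarketModel P T p d) : Icc (0 : ℝ) T := ⟨T, M.T_pos.le, le_rfl⟩

/-- The filtration is generated by the process `Y` and the null sets of `𝓕`. -/
def IsGenerated (M : MarketModel P T p d) : Prop :=
  ∀ t, M.filtration t =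
    (⨆ s ≤ t, MeasurableSpace.comap (M.Y s) inferInstance) ⊔
      MeasurableSpace.generateFrom {A : Set Ω | MeasurableSet A ∧ P A = 0}

/-- `Y` has independent increments, where `Y_{0-} = 0` and `Y_0` counts as an increment: the
process is extended by the value `0` at an additional time (`⊥`, playing the role of `0-`)
that precedes all the times of `[0, T]`. -/
def IndependentIncrements (M : MarketModel P T p d) : Prop :=
  HasIndepIncrements
    (fun t : WithBot (Icc (0 : ℝ) T) => t.recBotCoe (fun _ => 0) M.Y) P

/-- The model with the same processes `Y`, `S` whose filtration is initially enlarged by the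
random variable `ξ`, that is `𝓖_t = σ(𝓕_t, ξ)`. -/
def enlarge (M : MarketModel P T p d) (ξ : Ω → ℝ) (hξ : Measurable ξ) :
    MarketModel P T p d where
  T_pos := M.T_pos
  filtration :=
    { seq := fun t => M.filtration t ⊔ MeasurableSpace.comap ξ inferInstance
      mono' := fun _ _ h => sup_le_sup_right (M.filtration.mono h) _
      le' := fun t => sup_le (M.filtration.le t) hξ.comap_le }
  Y := M.Y
  Y_adapted := fun t => (M.Y_adapted t).mono le_sup_left le_rfl
  Y_rcll := M.Y_rcll
  S := M.S
  S_adapted := fun t => (M.S_adapted t).mono le_sup_left le_rfl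
  S_continuous := M.S_continuous
  S_pos := M.S_pos
  S_start := M.S_start
  S_numeraire := M.S_numeraire

/-- A strategy: an adapted process with RCLL and `K`-decreasing paths. Since `B_{0-} = 0`, the
initial trade `B_0` is also a `K`-decreasing move, i.e. `B_0 ∈ -K`. -/
structure IsStrategy (M : MarketModel P T p d) (K : ConvexCone ℝ (Fin d → ℝ))
    (B : Icc (0 : ℝ) T → Ω → (Fin d → ℝ)) : Prop where
  adapted : Adapted M.filtration B
  rcll : ∀ ω, IsRCLL fun t => B t ω
  decreasing : ∀ ω s t, s ≤ t → -(B t ω - B s ω) ∈ K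
  start_mem : ∀ ω, -(B M.start ω) ∈ K

/-- The portfolio wealth in physical units, `x^j + ∫_{[0,t]} (1 / S^j_s) dB^j_s`, where `dB` has
the mass `B_0` at time `0`. -/
def physicalWealth (M : MarketModel P T p d) (x : Fin d → ℝ)
    (B : Icc (0 : ℝ) T → Ω → (Fin d → ℝ)) (t : Icc (0 : ℝ) T) (ω : Ω) : Fin d → ℝ :=
  fun j => x j + (1 / M.S M.start ω j * B M.start ω j +
    rsIntegral (fun s => 1 / M.S s ω j) (fun s => B s ω j) M.start t)

/-- The portfolio wealth `V^{x,B}` in units of the numeraire. -/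
def wealth (M : MarketModel P T p d) (x : Fin d → ℝ)
    (B : Icc (0 : ℝ) T → Ω → (Fin d → ℝ)) (t : Icc (0 : ℝ) T) (ω : Ω) : Fin d → ℝ :=
  fun j => M.S t ω j * M.physicalWealth x B t ω j

/-- The class of admissible strategies for the initial value `x`. -/
def admissible (M : MarketModel P T p d) (K : ConvexCone ℝ (Fin d → ℝ)) (x : Fin d → ℝ) :
    Set (Icc (0 : ℝ) T → Ω → (Fin d → ℝ)) :=
  {B | M.IsStrategy K B ∧ ∀ t, ∀ᵐ ω ∂P, M.wealth x B t ω ∈ K}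

/-- The expectation `E Z = E Z⁺ - E Z⁻` of an extended real random variable, equal to `-∞` as soon
as `E Z⁻ = ∞` (in `EReal` one has `⊤ - ⊤ = ⊥`). -/
def expectation (P : Measure Ω) (Z : Ω → EReal) : EReal :=
  ((∫⁻ ω, (Z ω).toENNReal ∂P : ENNReal) : EReal) -
    ((∫⁻ ω, (-(Z ω)).toENNReal ∂P : ENNReal) : EReal)

/-- The Bellman function `u(x) = sup_{B ∈ 𝒜(x)} E U(V^{x,B}_T)`. -/
def bellman (M : MarketModel P T p d) (K : ConvexCone ℝ (Fin d → ℝ))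
    (U : (Fin d → ℝ) → EReal) (x : Fin d → ℝ) : EReal :=
  ⨆ B ∈ M.admissible K x, expectation P fun ω => U (M.wealth x B M.horizon ω)

end MarketModel

end KabanovMarket

end

/-!
The inequality `u(x, 𝐌) ≤ u(x, 𝐍)` holds because a strategy of the original model is a strategy of
the enlarged one. For the converse, `ξ` is frozen: an admissible strategy `B` of the enlarged model
has the form `B_t(ω) = b_t(ω, ξ(ω))`, where `b_t` is measurable with respect to `𝓕_t ⊗ 𝓑(ℝ)`. Because
`𝓕_T` is independent of `ξ`, Fubini's theorem writes `E U(V_T^{x,B})` as the average over the law of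
`ξ` of the expected utilities of the sections `b(·, z)`. If almost all of these sections are
admissible in the original model, each term is at most `u(x, 𝐌)`, hence so is the average
(`lintegral_sub_lintegral_le` takes care of `∞ - ∞ = -∞`).

The properties of the paths of `B` involve uncountably many times, while Fubini's theorem transfers
only countably many conditions to the sections. The section is therefore observed on a countable
dense set `D` of times and replaced by its limits from the right along `D` (`regularize`). These
exist, and give right-continuous `K`-decreasing paths, since a functional that dominates the norm
on the closed pointed cone `K` (`exists_norm_le_clm_of_salient`) bounds the oscillation of a
`K`-decreasing path by that of a monotone real function. The same functional writes the coordinates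
of such a path as differences of Stieltjes functions; so the Riemann–Stieltjes integrals exist, are
limits of sums and depend right-continuously on the upper limit, and it is enough to
check solvency of the sections at the times of `D`.

A limit from the right is known only immediately after time `t`. This is where the independence of
the increments is needed: it makes the filtration generated by `Y` and the null sets
right-continuous (`MarketModel.iInf_filtration_le`). An event known immediately after `t` is
independent of the increments after `t`, and a function of these increments and of the past, hence
a function of the past alone.
-/

noncomputable section

namespace KabanovMarket

set_option linter.unusedSectionVars false

/-! ### Cone-decreasing paths -/

section Cone

variable {E : Type*} [NormedAddCommGroup E] [NormedSpace ℝ E]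

/-- On a closed pointed cone in finite dimension, the norm is dominated by a linear functional.
Functionals that are nonnegative on the cone and positive at a given unit vector come from
separating the opposite vector; finitely many of them suffice by compactness of the sphere. -/
theorem exists_norm_le_clm_of_salient [FiniteDimensional ℝ E] (K : ConvexCone ℝ E)
    (hK : IsClosed (K : Set E)) (hK0 : (K : Set E) ∩ {z | -z ∈ K} = {0}) :
    ∃ l : E →L[ℝ] ℝ, ∀ v ∈ K, ‖v‖ ≤ l v := by
  have h0 : (0 : E) ∈ K := by
    have : (0 : E) ∈ (K : Set E) ∩ {z | -z ∈ K} := by rw [hK0]; rfl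
    exact this.1
  have hsep : ∀ v ∈ (K : Set E) ∩ Metric.sphere 0 1,
      ∃ f : E →L[ℝ] ℝ, (∀ w ∈ K, 0 ≤ f w) ∧ 0 < f v := by
    rintro v ⟨hv, hv1⟩
    have hnv : -v ∉ (K : Set E) := by
      intro h
      have : v ∈ (K : Set E) ∩ {z | -z ∈ K} := ⟨hv, h⟩
      rw [hK0, mem_singleton_iff] at this
      simp [this] at hv1
    obtain ⟨f, u, hfu, hf⟩ := geometric_hahn_banach_point_closed K.convex hK hnv
    have hu : u < 0 := by simpa using hf 0 h0
    refine ⟨f, fun w hw => ?_, ?_⟩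
    · by_contra! hneg
      have hc : 0 < u / f w := div_pos_of_neg_of_neg hu hneg
      have := hf _ (K.smul_mem hc hw)
      rw [map_smul, smul_eq_mul, div_mul_cancel₀ _ hneg.ne] at this
      exact lt_irrefl _ this
    · rw [map_neg] at hfu
      linarith
  have hcomp : IsCompact ((K : Set E) ∩ Metric.sphere 0 1) :=
    (isCompact_sphere 0 1).inter_left hK
  choose! F hF0 hFv using hsep
  obtain ⟨t, ht, htc⟩ := hcomp.elim_nhds_subcover (fun v => {w | 0 < F v w}) fun v hv =>
    (isOpen_lt continuous_const (F v).continuous).mem_nhds (hFv v hv)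
  set G : E →L[ℝ] ℝ := ∑ v ∈ t, F v with hG
  have hGpos : ∀ w ∈ (K : Set E) ∩ Metric.sphere 0 1, 0 < G w := by
    intro w hw
    obtain ⟨v, hv, hwv⟩ := mem_iUnion₂.1 (htc hw)
    rw [hG, sum_apply]
    exact Finset.sum_pos' (fun i hi => hF0 i (ht i hi) w hw.1) ⟨v, hv, hwv⟩
  obtain ⟨c, hc, hGc⟩ : ∃ c > 0, ∀ w ∈ (K : Set E) ∩ Metric.sphere 0 1, c ≤ G w := by
    rcases ((K : Set E) ∩ Metric.sphere 0 1).eq_empty_or_nonempty with he | hne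
    · exact ⟨1, one_pos, fun w hw => by simp [he] at hw⟩
    · obtain ⟨w, hw, hmin⟩ := hcomp.exists_isMinOn hne G.continuous.continuousOn
      exact ⟨G w, hGpos w hw, fun v hv => hmin hv⟩
  refine ⟨c⁻¹ • G, fun v hv => ?_⟩
  rcases eq_or_ne v 0 with rfl | hv0
  · simp
  have hn : 0 < ‖v‖ := norm_pos_iff.2 hv0
  have := hGc (‖v‖⁻¹ • v) ⟨K.smul_mem (inv_pos.2 hn) hv, by
    simp [norm_smul, inv_mul_cancel₀ hn.ne']⟩
  rw [map_smul, smul_eq_mul, le_inv_mul_iff₀ hn] at this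
  rw [smul_apply, smul_eq_mul, le_inv_mul_iff₀ hc]
  linarith

variable {ι : Type*}

/-- A path converges along a filter as soon as its oscillation is dominated by that of a
convergent real function. -/
theorem exists_tendsto_of_dist_le [CompleteSpace E] {F : Filter ι} [F.NeBot] {h : ι → E}
    {φ : ι → ℝ} {a : ℝ} (hφ : Tendsto φ F (𝓝 a)) {S : Set ι} (hS : S ∈ F)
    (hd : ∀ s ∈ S, ∀ t ∈ S, dist (h s) (h t) ≤ dist (φ s) (φ t)) :
    ∃ l, Tendsto h F (𝓝 l) := by
  refine cauchy_iff_exists_le_nhds.1 (Metric.cauchy_iff.2 ⟨inferInstance, fun ε hε => ?_⟩)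
  refine ⟨h '' (S ∩ φ ⁻¹' Metric.ball a (ε / 2)),
    image_mem_map (inter_mem hS (hφ (Metric.ball_mem_nhds a (half_pos hε)))), ?_⟩
  rintro _ ⟨s, ⟨hs, hsa⟩, rfl⟩ _ ⟨t, ⟨ht, hta⟩, rfl⟩
  have h1 := hd s hs t ht
  have h2 := dist_triangle_right (φ s) (φ t) a
  rw [mem_preimage, Metric.mem_ball] at hsa hta
  linarith

variable [LinearOrder ι] [TopologicalSpace ι] [OrderTopology ι]

/-- If `l` dominates the norm on `K`, the oscillation of a `K`-decreasing path is dominated by that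
of the real function `l ∘ h`. -/
theorem dist_le_dist_clm {K : ConvexCone ℝ E} {l : E →L[ℝ] ℝ} (hl : ∀ v ∈ K, ‖v‖ ≤ l v)
    {D : Set ι} {h : ι → E} (hh : ∀ s ∈ D, ∀ t ∈ D, s ≤ t → h s - h t ∈ K)
    {s t : ι} (hs : s ∈ D) (ht : t ∈ D) : dist (h s) (h t) ≤ dist (l (h s)) (l (h t)) := by
  rcases le_total s t with hst | hst
  · rw [dist_eq_norm, dist_eq_norm, ← map_sub]
    exact (hl _ (hh s hs t ht hst)).trans (le_abs_self _)
  · rw [dist_comm, dist_comm (l (h s)), dist_eq_norm, dist_eq_norm, ← map_sub]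
    exact (hl _ (hh t ht s hs hst)).trans (le_abs_self _)

/-- The right-continuous version of a path observed on the set `D` only: at `t`, the limit along the
points of `D` that lie strictly to the right of `t`; if there are none near `t`, the value
itself. -/
def rightLimOn (D : Set ι) (h : ι → E) (t : ι) : E :=
  open Classical in
  if 𝓝[D ∩ Ioi t] t = ⊥ then h t else limUnder (𝓝[D ∩ Ioi t] t) h

theorem rightLimOn_of_isMax (D : Set ι) (h : ι → E) {t : ι} (ht : IsMax t) :
    rightLimOn D h t = h t := by
  rw [rightLimOn, if_pos]
  simp [ht.Ioi_eq]

theorem nhdsWithin_inter_Ioi_neBot [DenselyOrdered ι] {D : Set ι} (hD : Dense D) {t : ι}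
    (ht : ¬ IsMax t) : (𝓝[D ∩ Ioi t] t).NeBot := by
  rw [← mem_closure_iff_nhdsWithin_neBot, inter_comm]
  refine closure_minimal (hD.open_subset_closure_inter isOpen_Ioi) isClosed_closure ?_
  obtain ⟨q, hq⟩ := not_isMax_iff.1 ht
  rw [closure_Ioi' ⟨q, hq⟩]
  exact self_mem_Ici

section Decreasing

variable [FiniteDimensional ℝ E] [DenselyOrdered ι]
  {K : ConvexCone ℝ E} {l : E →L[ℝ] ℝ} {D : Set ι} {h : ι → E}

theorem tendsto_rightLimOn (hl : ∀ v ∈ K, ‖v‖ ≤ l v)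
    (hD : Dense D) (hDbot : ∃ b ∈ D, ∀ t, b ≤ t)
    (hh : ∀ s ∈ D, ∀ t ∈ D, s ≤ t → h s - h t ∈ K) {t : ι} (ht : ¬ IsMax t) :
    Tendsto h (𝓝[D ∩ Ioi t] t) (𝓝 (rightLimOn D h t)) := by
  have hne := nhdsWithin_inter_Ioi_neBot hD ht
  have := FiniteDimensional.complete ℝ E
  rw [rightLimOn, if_neg hne.ne]
  apply tendsto_nhds_limUnder
  have hanti : ∀ s ∈ D, ∀ t ∈ D, s ≤ t → l (h t) ≤ l (h s) := fun s hs t ht hst => by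
    have := (norm_nonneg _).trans (hl _ (hh s hs t ht hst))
    rwa [map_sub, sub_nonneg] at this
  obtain ⟨b, hbD, hb⟩ := hDbot
  have hmem : D ∩ Ioi t ∈ 𝓝[D ∩ Ioi t] t := self_mem_nhdsWithin
  have hbdd : BddAbove ((fun s => l (h s)) '' (D ∩ Ioi t)) :=
    ⟨l (h b), by rintro _ ⟨s, hs, rfl⟩; exact hanti b hbD s hs.1 (hb s)⟩
  have hnonempty := (Filter.nonempty_of_mem hmem).image (fun s => l (h s))
  have hlim : Tendsto (fun s => l (h s)) (𝓝[D ∩ Ioi t] t)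
      (𝓝 (sSup ((fun s => l (h s)) '' (D ∩ Ioi t)))) := by
    refine tendsto_order.2 ⟨fun a ha => ?_, fun a ha => ?_⟩
    · obtain ⟨_, ⟨q, hq, rfl⟩, hqa⟩ := exists_lt_of_lt_csSup hnonempty ha
      filter_upwards [hmem, nhdsWithin_le_nhds (Iio_mem_nhds hq.2)] with s hs hsq
      exact hqa.trans_le (hanti s hs.1 q hq.1 (le_of_lt hsq))
    · filter_upwards [hmem] with s hs
      exact (le_csSup hbdd ⟨s, hs, rfl⟩).trans_lt ha
  exact exists_tendsto_of_dist_le hlim hmem fun s hs t ht => dist_le_dist_clm hl hh hs.1 ht.1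

theorem rightLimOn_sub_mem (hK : IsClosed (K : Set E)) (hl : ∀ v ∈ K, ‖v‖ ≤ l v)
    (hD : Dense D) (hDbot : ∃ b ∈ D, ∀ t, b ≤ t)
    (hh : ∀ s ∈ D, ∀ t ∈ D, s ≤ t → h s - h t ∈ K) {s q : ι} (hq : q ∈ D) (hsq : s < q) :
    rightLimOn D h s - h q ∈ K := by
  have hs : ¬ IsMax s := not_isMax_iff.2 ⟨q, hsq⟩
  have := nhdsWithin_inter_Ioi_neBot hD hs
  refine hK.mem_of_tendsto ((tendsto_rightLimOn hl hD hDbot hh hs).sub_const (h q)) ?_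
  filter_upwards [self_mem_nhdsWithin, nhdsWithin_le_nhds (Iio_mem_nhds hsq)] with r hr hrq
  exact hh r hr.1 q hq (le_of_lt hrq)

theorem sub_rightLimOn_mem (hK : IsClosed (K : Set E)) (hl : ∀ v ∈ K, ‖v‖ ≤ l v)
    (hD : Dense D) (hDbot : ∃ b ∈ D, ∀ t, b ≤ t) (hDmax : ∀ t, IsMax t → t ∈ D)
    (hh : ∀ s ∈ D, ∀ t ∈ D, s ≤ t → h s - h t ∈ K) {q s : ι} (hq : q ∈ D) (hqs : q ≤ s) :
    h q - rightLimOn D h s ∈ K := by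
  by_cases hs : IsMax s
  · rw [rightLimOn_of_isMax D h hs]
    exact hh q hq s (hDmax s hs) hqs
  have := nhdsWithin_inter_Ioi_neBot hD hs
  refine hK.mem_of_tendsto ((tendsto_rightLimOn hl hD hDbot hh hs).const_sub (h q)) ?_
  filter_upwards [self_mem_nhdsWithin] with r hr
  exact hh q hq r hr.1 (hqs.trans (le_of_lt hr.2))

theorem rightLimOn_sub_rightLimOn_mem (hK : IsClosed (K : Set E)) (h0 : 0 ∈ K)
    (hl : ∀ v ∈ K, ‖v‖ ≤ l v)
    (hD : Dense D) (hDbot : ∃ b ∈ D, ∀ t, b ≤ t) (hDmax : ∀ t, IsMax t → t ∈ D)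
    (hh : ∀ s ∈ D, ∀ t ∈ D, s ≤ t → h s - h t ∈ K) {s t : ι} (hst : s ≤ t) :
    rightLimOn D h s - rightLimOn D h t ∈ K := by
  rcases hst.eq_or_lt with rfl | hlt
  · simpa using h0
  obtain ⟨q, hq, hsq, hqt⟩ := hD.exists_between hlt
  have := K.add_mem (rightLimOn_sub_mem hK hl hD hDbot hh hq hsq)
    (sub_rightLimOn_mem hK hl hD hDbot hDmax hh hq hqt.le)
  simpa using this

theorem continuousWithinAt_rightLimOn (hK : IsClosed (K : Set E)) (h0 : 0 ∈ K)
    (hl : ∀ v ∈ K, ‖v‖ ≤ l v)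
    (hD : Dense D) (hDbot : ∃ b ∈ D, ∀ t, b ≤ t) (hDmax : ∀ t, IsMax t → t ∈ D)
    (hh : ∀ s ∈ D, ∀ t ∈ D, s ≤ t → h s - h t ∈ K) (t : ι) :
    ContinuousWithinAt (rightLimOn D h) (Ici t) t := by
  by_cases ht : IsMax t
  · rw [ht.Ici_eq]
    exact continuousWithinAt_singleton
  have := nhdsWithin_inter_Ioi_neBot hD ht
  rw [ContinuousWithinAt, Metric.tendsto_nhds]
  intro ε hε
  have hlim : Tendsto (fun q => l (rightLimOn D h t) - l (h q)) (𝓝[D ∩ Ioi t] t) (𝓝 0) := by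
    have := (l.continuous.tendsto _).comp (tendsto_rightLimOn hl hD hDbot hh ht)
    simpa using this.const_sub (l (rightLimOn D h t))
  obtain ⟨q, hqε, hqD, hqt⟩ := ((hlim.eventually (gt_mem_nhds hε)).and self_mem_nhdsWithin).exists
  filter_upwards [self_mem_nhdsWithin, nhdsWithin_le_nhds (Iio_mem_nhds hqt)] with s hs hsq
  have h1 := hl _ (rightLimOn_sub_rightLimOn_mem hK h0 hl hD hDbot hDmax hh hs)
  have h2 := (norm_nonneg _).trans (hl _ (rightLimOn_sub_mem hK hl hD hDbot hh hqD hsq))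
  rw [map_sub] at h1 h2
  rw [dist_comm, dist_eq_norm]
  linarith

theorem rightLimOn_eq_self (hD : Dense D) {t : ι} (ht : ContinuousWithinAt h (Ici t) t) :
    rightLimOn D h t = h t := by
  by_cases hm : IsMax t
  · exact rightLimOn_of_isMax D h hm
  · have hne := nhdsWithin_inter_Ioi_neBot hD hm
    rw [rightLimOn, if_neg hne.ne]
    exact (ht.mono_left (nhdsWithin_mono _ fun s hs => le_of_lt hs.2)).limUnder_eq

theorem exists_tendsto_nhdsLT (hl : ∀ v ∈ K, ‖v‖ ≤ l v)
    (hh : ∀ s t, s ≤ t → h s - h t ∈ K) (t : ι) : ∃ v, Tendsto h (𝓝[<] t) (𝓝 v) := by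
  rcases (𝓝[<] t).eq_or_neBot with hb | hne
  · exact ⟨0, by rw [hb]; exact tendsto_bot⟩
  have := FiniteDimensional.complete ℝ E
  have hmono : Monotone fun s => -l (h s) := fun s t hst => by
    have := (norm_nonneg _).trans (hl _ (hh s t hst))
    rw [map_sub, sub_nonneg] at this
    exact neg_le_neg this
  have hlim := (hmono.tendsto_leftLim t).neg
  simp only [neg_neg] at hlim
  exact exists_tendsto_of_dist_le hlim univ_mem fun s hs t ht =>
    dist_le_dist_clm (D := univ) hl (fun s _ t _ => hh s t) hs ht

end Decreasing

end Cone

/-! ### Riemann–Stieltjes integrals against paths of finite variation -/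

section RiemannStieltjes

variable {T : ℝ}

/-- The `k`-th point of the partition of `[a, b]` into `n` intervals of equal length (and `b` for
`k ≥ n`). -/
def uniformPartition (a b : Icc (0 : ℝ) T) (n k : ℕ) : Icc (0 : ℝ) T :=
  projIcc 0 T (a.2.1.trans a.2.2) (a + min ((k : ℝ) / n) 1 * (b - a))

theorem uniformPartition_zero (a b : Icc (0 : ℝ) T) (n : ℕ) : uniformPartition a b n 0 = a := by
  simp [uniformPartition]

theorem uniformPartition_self (a b : Icc (0 : ℝ) T) {n : ℕ} (hn : n ≠ 0) :
    uniformPartition a b n n = b := by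
  simp [uniformPartition, hn]

theorem monotone_uniformPartition {a b : Icc (0 : ℝ) T} (hab : a ≤ b) (n : ℕ) :
    Monotone (uniformPartition a b n) := by
  intro i j hij
  apply monotone_projIcc
  have : (0 : ℝ) ≤ b - a := sub_nonneg.2 hab
  gcongr

theorem uniformPartition_succ_sub_le {a b : Icc (0 : ℝ) T} (hab : a ≤ b) (n k : ℕ) :
    (uniformPartition a b n (k + 1) : ℝ) - uniformPartition a b n k ≤ (b - a) / n := by
  have hba : (0 : ℝ) ≤ b - a := sub_nonneg.2 hab
  have hcoe : ∀ m, (uniformPartition a b n m : ℝ) = a + min ((m : ℝ) / n) 1 * (b - a) := by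
    intro m
    rw [uniformPartition, projIcc_of_mem (hx := ⟨?_, ?_⟩)]
    · have := a.2.1
      positivity
    · have h1 : min ((m : ℝ) / n) 1 * (b - a) ≤ 1 * (b - a) :=
        mul_le_mul_of_nonneg_right (min_le_right _ _) hba
      have := b.2.2
      linarith
  rw [hcoe, hcoe]
  have h2 : min (((k + 1 : ℕ) : ℝ) / n) 1 ≤ min ((k : ℝ) / n) 1 + 1 / n := by
    have hn : (0 : ℝ) ≤ 1 / n := by positivity
    rw [← min_add_add_right]
    refine min_le_min (by push_cast; rw [add_div]) (by linarith)
  have h3 := mul_le_mul_of_nonneg_right h2 hba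
  have h4 : (b - a : ℝ) / n = 1 / n * (b - a) := by ring
  rw [h4]
  linarith

/-- The Riemann–Stieltjes sum of `f` against `g` along the uniform partition, with the left end
points as tags. -/
def uniformSum (f g : Icc (0 : ℝ) T → ℝ) (a b : Icc (0 : ℝ) T) (n : ℕ) : ℝ :=
  ∑ i ∈ Finset.range n, f (uniformPartition a b n i) *
    (g (uniformPartition a b n (i + 1)) - g (uniformPartition a b n i))

theorem HasRSIntegral.tendsto_uniformSum {f g : Icc (0 : ℝ) T → ℝ} {a b : Icc (0 : ℝ) T} {I : ℝ}
    (h : HasRSIntegral f g a b I) (hab : a ≤ b) :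
    Tendsto (uniformSum f g a b) atTop (𝓝 I) := by
  rw [Metric.tendsto_nhds]
  intro ε hε
  obtain ⟨δ, hδ, hI⟩ := h ε hε
  have hmesh : ∀ᶠ n : ℕ in atTop, ((b : ℝ) - a) / n < δ :=
    (tendsto_const_div_atTop_nhds_zero_nat _).eventually (gt_mem_nhds hδ)
  filter_upwards [hmesh, eventually_ne_atTop 0] with n hn hn0
  exact hI n _ _ (monotone_uniformPartition hab n) (uniformPartition_zero a b n)
    (uniformPartition_self a b hn0)
    (fun i _ => ⟨le_rfl, monotone_uniformPartition hab n i.le_succ⟩)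
    (fun i _ => (uniformPartition_succ_sub_le hab n i).trans_lt hn)

theorem HasRSIntegral.rsIntegral_eq {f g : Icc (0 : ℝ) T → ℝ} {a b : Icc (0 : ℝ) T} {I : ℝ}
    (h : HasRSIntegral f g a b I) (hab : a ≤ b) : rsIntegral f g a b = I := by
  have hex : ∃ I, HasRSIntegral f g a b I := ⟨I, h⟩
  rw [rsIntegral, dif_pos hex]
  exact tendsto_nhds_unique (hex.choose_spec.tendsto_uniformSum hab) (h.tendsto_uniformSum hab)

theorem HasRSIntegral.sub {f g g' : Icc (0 : ℝ) T → ℝ} {a b : Icc (0 : ℝ) T} {I I' : ℝ}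
    (h : HasRSIntegral f g a b I) (h' : HasRSIntegral f g' a b I') :
    HasRSIntegral f (fun t => g t - g' t) a b (I - I') := by
  intro ε hε
  obtain ⟨δ, hδ, h⟩ := h (ε / 2) (half_pos hε)
  obtain ⟨δ', hδ', h'⟩ := h' (ε / 2) (half_pos hε)
  refine ⟨min δ δ', lt_min hδ hδ', fun n p τ hp h0 hn hτ hm => ?_⟩
  have h1 := h n p τ hp h0 hn hτ fun i hi => (hm i hi).trans_le (min_le_left _ _)
  have h2 := h' n p τ hp h0 hn hτ fun i hi => (hm i hi).trans_le (min_le_right _ _)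
  have h3 : ∑ i ∈ Finset.range n, f (τ i) * (g (p (i + 1)) - g' (p (i + 1)) - (g (p i) - g' (p i)))
      = ∑ i ∈ Finset.range n, f (τ i) * (g (p (i + 1)) - g (p i))
        - ∑ i ∈ Finset.range n, f (τ i) * (g' (p (i + 1)) - g' (p i)) := by
    rw [← Finset.sum_sub_distrib]
    exact Finset.sum_congr rfl fun i _ => by ring
  rw [h3]
  rw [abs_lt] at *
  constructor <;> linarith

instance : CompactIccSpace (Icc (0 : ℝ) T) := ⟨fun {_ _} => isClosed_Icc.isCompact⟩

variable (g : StieltjesFunction (Icc (0 : ℝ) T)) {f : Icc (0 : ℝ) T → ℝ}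

theorem measureReal_Ioc_of_le {a b : Icc (0 : ℝ) T} (hab : a ≤ b) :
    g.measure.real (Ioc a b) = g b - g a := by
  rw [Measure.real, g.measure_Ioc, ENNReal.toReal_ofReal (sub_nonneg.2 (g.mono hab))]

theorem integrableOn_Ioc_of_continuous (hf : Continuous f) (a b : Icc (0 : ℝ) T) :
    IntegrableOn f (Ioc a b) g.measure :=
  (hf.continuousOn.integrableOn_compact (μ := g.measure) isCompact_univ).mono_set (subset_univ _)

/-- Against a monotone right-continuous path, the Riemann–Stieltjes integral is the integral with
respect to the associated measure. -/
theorem hasRSIntegral_stieltjes (hf : Continuous f) (a b : Icc (0 : ℝ) T) :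
    HasRSIntegral f g a b (∫ x in Ioc a b, f x ∂g.measure) := by
  intro ε hε
  have hη : 0 < ε / (|g b - g a| + 1) := by positivity
  obtain ⟨δ, hδ, hfδ⟩ := Metric.uniformContinuous_iff.1
    (CompactSpace.uniformContinuous_of_continuous hf) _ hη
  refine ⟨δ, hδ, fun n p τ hp h0 hn hτ hm => ?_⟩
  have hsplit : ∀ n, ∫ x in Ioc (p 0) (p n), f x ∂g.measure
      = ∑ i ∈ Finset.range n, ∫ x in Ioc (p i) (p (i + 1)), f x ∂g.measure := by
    intro n
    induction n with
    | zero => simp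
    | succ n ih =>
      rw [Finset.sum_range_succ, ← ih, ← setIntegral_union _ measurableSet_Ioc
        (integrableOn_Ioc_of_continuous g hf _ _) (integrableOn_Ioc_of_continuous g hf _ _),
        Ioc_union_Ioc_eq_Ioc (hp n.zero_le) (hp n.le_succ)]
      exact Ioc_disjoint_Ioc_of_le le_rfl
  rw [← h0, ← hn, hsplit, ← Finset.sum_sub_distrib]
  have hterm : ∀ i ∈ Finset.range n,
      |f (τ i) * (g (p (i + 1)) - g (p i)) - ∫ x in Ioc (p i) (p (i + 1)), f x ∂g.measure|
        ≤ ε / (|g b - g a| + 1) * (g (p (i + 1)) - g (p i)) := by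
    intro i hi
    rw [Finset.mem_range] at hi
    have hle := hp i.le_succ
    have hfin : g.measure (Ioc (p i) (p (i + 1))) < ⊤ := by simp
    have hconst : f (τ i) * (g (p (i + 1)) - g (p i))
        = ∫ _ in Ioc (p i) (p (i + 1)), f (τ i) ∂g.measure := by
      rw [setIntegral_const, measureReal_Ioc_of_le g hle, smul_eq_mul, mul_comm]
    rw [hconst, ← integral_sub (IntegrableOn.integrable (integrableOn_const (C := f (τ i)) hfin.ne))
      (integrableOn_Ioc_of_continuous g hf _ _), ← measureReal_Ioc_of_le g hle, ← Real.norm_eq_abs]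
    refine norm_setIntegral_le_of_norm_le_const hfin fun x hx => ?_
    rw [← dist_eq_norm]
    refine (hfδ ?_).le
    have h1 := hm i hi
    have h2 : (p i : ℝ) ≤ τ i := (hτ i hi).1
    have h3 : (τ i : ℝ) ≤ p (i + 1) := (hτ i hi).2
    have h4 : (p i : ℝ) < x := hx.1
    have h5 : (x : ℝ) ≤ p (i + 1) := hx.2
    rw [Subtype.dist_eq, Real.dist_eq, abs_lt]
    constructor <;> linarith
  calc _ ≤ ∑ i ∈ Finset.range n, ε / (|g b - g a| + 1) * (g (p (i + 1)) - g (p i)) :=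
        (Finset.abs_sum_le_sum_abs _ _).trans (Finset.sum_le_sum hterm)
    _ = ε / (|g b - g a| + 1) * (g b - g a) := by
        rw [← Finset.mul_sum, Finset.sum_range_sub (fun i => g (p i)), hn, h0]
    _ ≤ ε / (|g b - g a| + 1) * |g b - g a| := by gcongr; exact le_abs_self _
    _ < ε := by
        rw [div_mul_eq_mul_div, div_lt_iff₀ (by positivity)]
        linarith

theorem continuousWithinAt_setIntegral_Ioc (hf : Continuous f) {a t : Icc (0 : ℝ) T} (hat : a ≤ t) :
    ContinuousWithinAt (fun b => ∫ x in Ioc a b, f x ∂g.measure) (Ici t) t := by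
  obtain ⟨C, hC⟩ := isCompact_univ.exists_bound_of_continuousOn hf.continuousOn
  have hlim : Tendsto (fun b => C * (g b - g t)) (𝓝[≥] t) (𝓝 0) := by
    have : Tendsto (fun b => g b - g t) (𝓝[≥] t) (𝓝 (g t - g t)) :=
      (g.right_continuous t).sub_const (g t)
    simpa using this.const_mul C
  rw [ContinuousWithinAt, tendsto_iff_norm_sub_tendsto_zero]
  refine squeeze_zero' (Eventually.of_forall fun b => norm_nonneg _) ?_ hlim
  filter_upwards [self_mem_nhdsWithin] with b hb
  rw [← Ioc_union_Ioc_eq_Ioc hat hb, setIntegral_union (Ioc_disjoint_Ioc_of_le le_rfl)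
    measurableSet_Ioc (integrableOn_Ioc_of_continuous g hf _ _)
    (integrableOn_Ioc_of_continuous g hf _ _), add_sub_cancel_left, ← measureReal_Ioc_of_le g hb]
  exact norm_setIntegral_le_of_norm_le_const (by simp) fun x _ => hC x trivial

end RiemannStieltjes

/-- If the increments of a right-continuous path are dominated by those of a right-continuous
monotone function, the Riemann–Stieltjes integral of a continuous function exists, and it is
right-continuous in the upper limit: the path is the difference of two Stieltjes functions. -/
theorem exists_hasRSIntegral {T : ℝ} {f g φ : Icc (0 : ℝ) T → ℝ} (hf : Continuous f)
    (hg : ∀ t, ContinuousWithinAt g (Ici t) t) (hφ : ∀ t, ContinuousWithinAt φ (Ici t) t)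
    (hgφ : ∀ s t, s ≤ t → |g t - g s| ≤ φ t - φ s) (a : Icc (0 : ℝ) T) :
    ∃ I : Icc (0 : ℝ) T → ℝ, (∀ b, HasRSIntegral f g a b (I b)) ∧
      ∀ t, a ≤ t → ContinuousWithinAt I (Ici t) t := by
  -- `φ + g` is monotone because `φ` grows at least as much as `g` decreases.
  let G₁ : StieltjesFunction (Icc (0 : ℝ) T) :=
    ⟨fun t => φ t + g t, fun s t hst => by have := abs_le.1 (hgφ s t hst); dsimp only; linarith,
      fun t => (hφ t).add (hg t)⟩
  let G₂ : StieltjesFunction (Icc (0 : ℝ) T) :=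
    ⟨φ, fun s t hst => by linarith [abs_nonneg (g t - g s), hgφ s t hst], hφ⟩
  refine ⟨fun b => ∫ x in Ioc a b, f x ∂G₁.measure - ∫ x in Ioc a b, f x ∂G₂.measure,
    fun b => ?_, fun t hat => (continuousWithinAt_setIntegral_Ioc G₁ hf hat).sub
      (continuousWithinAt_setIntegral_Ioc G₂ hf hat)⟩
  have h := (hasRSIntegral_stieltjes G₁ hf a b).sub (hasRSIntegral_stieltjes G₂ hf a b)
  have hG : (fun t => G₁ t - G₂ t) = g := funext fun t => add_sub_cancel_left (φ t) (g t)
  rwa [hG] at h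

/-! ### Independence and null sets -/

section Independence

variable {Ω : Type*} {m₀ m₁ m₁' m₂ : MeasurableSpace Ω} [mΩ : MeasurableSpace Ω] {P : Measure Ω}

theorem setIntegral_eq_mul_of_indep [IsProbabilityMeasure P]
    (h₁ : m₁ ≤ mΩ) (h₂ : m₂ ≤ mΩ) (h : Indep m₁ m₂ P) {Z : Ω → ℝ}
    (hZ : StronglyMeasurable[m₁] Z) (hZi : Integrable Z P) {C : Set Ω}
    (hC : MeasurableSet[m₂] C) : ∫ ω in C, Z ω ∂P = P.real C * ∫ ω, Z ω ∂P := by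
  rw [← setIntegral_condExp h₂ hZi hC,
    setIntegral_congr_ae (h₂ _ hC) ((condExp_indep_eq h₁ h₂ hZ h).mono fun ω hω _ => hω),
    setIntegral_const, smul_eq_mul]

/-- Enlarging a σ-algebra by sets that are almost surely equal to its members keeps
independence. -/
theorem _root_.ProbabilityTheory.Indep.of_le_eventuallyMeasurableSpace
    (h : Indep m₁ m₂ P)
    (hle : m₁' ≤ eventuallyMeasurableSpace m₁ (ae P)) : Indep m₁' m₂ P := by
  rw [Indep_iff] at h ⊢
  intro s t hs ht
  obtain ⟨s', hs', hss'⟩ := hle s hs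
  rw [measure_congr hss', measure_congr (hss'.inter (EventuallyEq.refl _ t)), h s' t hs' ht]

/-- Let `m₀ ≤ m₁` with `m₁` independent of `m₂`. An event of `m₁` that belongs to `m₀ ⊔ m₂` up to
null sets belongs to `m₀` up to null sets: since `m₂` is independent of `m₁`, conditioning on
`m₀ ⊔ m₂` is the same as conditioning on `m₀`. -/
theorem exists_measurableSet_ae_eq_of_indep [IsProbabilityMeasure P]
    (h₀ : m₀ ≤ m₁) (h₁ : m₁ ≤ mΩ) (h₂ : m₂ ≤ mΩ)
    (h : Indep m₁ m₂ P) {A : Set Ω} (hA : MeasurableSet[m₁] A)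
    (hA' : MeasurableSet[eventuallyMeasurableSpace (m₀ ⊔ m₂) (ae P)] A) :
    ∃ B, MeasurableSet[m₀] B ∧ A =ᵐ[P] B := by
  obtain ⟨A', hA'm, hAA'⟩ := hA'
  have hsup : m₀ ⊔ m₂ ≤ mΩ := sup_le (h₀.trans h₁) h₂
  set f : Ω → ℝ := A.indicator 1 with hf
  have hfi : Integrable f P := (integrable_const 1).indicator (h₁ _ hA)
  have hfm : StronglyMeasurable[m₁] f := stronglyMeasurable_one.indicator hA
  set X : Ω → ℝ := P[f | m₀] with hX
  have hXi : Integrable X P := integrable_condExp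
  have hXm : StronglyMeasurable[m₀] X := stronglyMeasurable_condExp
  have hZi : Integrable (X - f) P := hXi.sub hfi
  have hZm : StronglyMeasurable[m₁] (X - f) := (hXm.mono h₀).sub hfm
  have hZ0 : ∀ H, MeasurableSet[m₀] H → ∫ ω in H, (X - f) ω ∂P = 0 := fun H hH => by
    simp only [Pi.sub_apply]
    rw [integral_sub hXi.integrableOn hfi.integrableOn, setIntegral_condExp (h₀.trans h₁) hfi hH,
      sub_self]
  have hZint : ∫ ω, (X - f) ω ∂P = 0 := by
    rw [← setIntegral_univ]; exact hZ0 _ MeasurableSet.univ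
  have hZ : ∀ D, MeasurableSet[m₀ ⊔ m₂] D → ∫ ω in D, (X - f) ω ∂P = 0 := by
    intro D hD
    have hgen : m₀ ⊔ m₂ = MeasurableSpace.generateFrom
        {D | ∃ H C, MeasurableSet[m₀] H ∧ MeasurableSet[m₂] C ∧ D = H ∩ C} := by
      apply le_antisymm
      · refine sup_le (fun H hH => ?_) fun C hC => ?_
        · exact MeasurableSpace.measurableSet_generateFrom
            ⟨H, univ, hH, MeasurableSet.univ, (inter_univ H).symm⟩
        · exact MeasurableSpace.measurableSet_generateFrom
            ⟨univ, C, MeasurableSet.univ, hC, (univ_inter C).symm⟩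
      · refine MeasurableSpace.generateFrom_le ?_
        rintro _ ⟨H, C, hH, hC, rfl⟩
        exact MeasurableSet.inter ((le_sup_left : m₀ ≤ m₀ ⊔ m₂) _ hH)
          ((le_sup_right : m₂ ≤ m₀ ⊔ m₂) _ hC)
    have hpi : IsPiSystem
        {D | ∃ H C, MeasurableSet[m₀] H ∧ MeasurableSet[m₂] C ∧ D = H ∩ C} := by
      rintro _ ⟨H, C, hH, hC, rfl⟩ _ ⟨H', C', hH', hC', rfl⟩ -
      exact ⟨H ∩ H', C ∩ C', hH.inter hH', hC.inter hC', inter_inter_inter_comm _ _ _ _⟩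
    refine MeasurableSpace.induction_on_inter
      (C := fun D _ => ∫ ω in D, (X - f) ω ∂P = 0) hgen hpi ?_ ?_ ?_ ?_ D hD
    · simp
    · rintro _ ⟨H, C, hH, hC, rfl⟩
      rw [inter_comm, ← setIntegral_indicator (h₁ _ (h₀ _ hH)),
        setIntegral_eq_mul_of_indep h₁ h₂ h (hZm.indicator (h₀ _ hH))
          (hZi.indicator (h₁ _ (h₀ _ hH))) hC,
        integral_indicator (h₁ _ (h₀ _ hH)), hZ0 H hH, mul_zero]
    · intro t ht h0
      have := integral_add_compl (hsup _ ht) hZi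
      rw [h0, hZint, zero_add] at this
      exact this
    · intro s hd hs h0
      rw [integral_iUnion (fun i => hsup _ (hs i)) hd hZi.integrableOn]
      exact (tsum_congr h0).trans tsum_zero
  have hXf : X =ᵐ[P] P[f | m₀ ⊔ m₂] := by
    refine ae_eq_condExp_of_forall_setIntegral_eq hsup hfi (fun s _ _ => hXi.integrableOn)
      (fun D hD _ => ?_) ⟨X, hXm.mono le_sup_left, EventuallyEq.rfl⟩
    have := hZ D hD
    simp only [Pi.sub_apply] at this
    rw [integral_sub hXi.integrableOn hfi.integrableOn] at this
    linarith
  have hff' : f =ᵐ[P] A'.indicator 1 := indicator_ae_eq_of_ae_eq_set hAA'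
  have hf' : P[f | m₀ ⊔ m₂] =ᵐ[P] A'.indicator 1 := by
    refine (condExp_congr_ae hff').trans (EventuallyEq.of_eq ?_)
    exact condExp_of_stronglyMeasurable hsup (stronglyMeasurable_one.indicator hA'm)
      ((integrable_const 1).indicator (hsup _ hA'm))
  refine ⟨X ⁻¹' {1}, hXm.measurable (MeasurableSet.singleton (1 : ℝ)), ?_⟩
  filter_upwards [(hXf.trans hf').trans hff'.symm] with ω hω
  refine propext ?_
  change ω ∈ A ↔ X ω = 1
  rw [hω, hf]
  by_cases hωA : ω ∈ A <;> simp [hωA]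

end Independence

/-! ### Processes with independent increments -/

section Increments

variable {Ω : Type*} [mΩ : MeasurableSpace Ω] {P : Measure Ω} {ι E : Type*} [LinearOrder ι]

theorem exists_monotone_nat_range (F : Finset ι) (hF : F.Nonempty) :
    ∃ t : ℕ → ι, Monotone t ∧ ∀ r ∈ F, ∃ i, t i = r := by
  have hc : 0 < F.card := hF.card_pos
  refine ⟨fun n => F.orderEmbOfFin rfl ⟨min n (F.card - 1), by omega⟩, fun i j hij => ?_,
    fun r hr => ?_⟩
  · refine (F.orderEmbOfFin rfl).monotone ?_
    simp only [Fin.mk_le_mk]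
    omega
  · have : r ∈ range (F.orderEmbOfFin rfl) := by simpa using hr
    obtain ⟨⟨i, hi⟩, rfl⟩ := this
    refine ⟨i, congrArg _ (Fin.ext ?_)⟩
    simp only
    omega

variable [AddCommGroup E] [MeasurableSpace E] [MeasurableAdd₂ E] [MeasurableSub₂ E]

/-- The past of a process with independent increments, started at `0`, is independent of its future
increments. -/
theorem _root_.ProbabilityTheory.HasIndepIncrements.indepFun_past_future [OrderBot ι]
    [IsProbabilityMeasure P] {X : ι → Ω → E} (hX : HasIndepIncrements X P)
    (hm : ∀ t, Measurable (X t)) (hbot : ∀ ω, X ⊥ ω = 0) (s : ι) :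
    IndepFun (fun ω (r : Iic s) => X r ω) (fun ω (u : Ici s) => X u ω - X s ω) P := by
  refine IndepFun.process_indepFun_process (fun r => hm r) (fun u => (hm u).sub (hm s))
    fun I J => ?_
  classical
  obtain ⟨t, ht, htF⟩ := exists_monotone_nat_range
    (insert ⊥ (insert s (I.image Subtype.val ∪ J.image Subtype.val)))
    ⟨⊥, Finset.mem_insert_self _ _⟩
  have ht0 : t 0 = ⊥ := by
    obtain ⟨i, hi⟩ := htF ⊥ (by simp)
    exact le_bot_iff.1 (hi ▸ ht i.zero_le)
  obtain ⟨k, hk⟩ := htF s (by simp)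
  have hind := hX.nat ht
  have hsplit := indep_iSup_of_disjoint
    (fun i => ((hm (t (i + 1))).sub (hm (t i))).comap_le) hind.iIndep
    (S := Iio k) (T := Ici k) (Set.disjoint_left.2 fun i hi hi' =>
      absurd (mem_Iio.1 hi) (not_lt.2 (mem_Ici.1 hi')))
  -- Increments between the times `t m` and `t n` are sums of the basic increments in between.
  have hincr : ∀ (S : Set ℕ) (m n : ℕ), m ≤ n → (∀ i, m ≤ i → i < n → i ∈ S) →
      Measurable[⨆ i ∈ S, MeasurableSpace.comap (fun ω => X (t (i + 1)) ω - X (t i) ω)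
        inferInstance] (fun ω => X (t n) ω - X (t m) ω) := by
    intro S m n hmn
    induction n, hmn using Nat.le_induction with
    | base => intro _; simp only [sub_self]; exact measurable_const
    | succ n hmn ih =>
      intro hS
      have h1 := ih fun i hi hin => hS i hi (hin.trans n.lt_succ_self)
      have h2 : Measurable[⨆ i ∈ S, MeasurableSpace.comap
          (fun ω => X (t (i + 1)) ω - X (t i) ω) inferInstance]
          (fun ω => X (t (n + 1)) ω - X (t n) ω) :=
        (comap_measurable _).mono (le_iSup₂_of_le n (hS n hmn n.lt_succ_self) le_rfl) le_rfl
      convert h2.add h1 using 1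
      ext ω
      exact (sub_add_sub_cancel _ _ _).symm
  refine indep_of_indep_of_le_left (indep_of_indep_of_le_right hsplit ?_) ?_
  · refine Measurable.comap_le ?_
    refine @measurable_pi_lambda _ _ _ (_) _ _ fun u => ?_
    obtain ⟨i, hi⟩ := htF u (Finset.mem_insert_of_mem (Finset.mem_insert_of_mem
      (Finset.mem_union_right _ (Finset.mem_image_of_mem _ u.2))))
    have hmax : t (max i k) = u := by
      rw [ht.map_max, hi, hk]
      exact max_eq_left u.1.2
    have := hincr (Ici k) k (max i k) (le_max_right _ _) fun i hi _ => hi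
    rwa [hmax, hk] at this
  · refine Measurable.comap_le ?_
    refine @measurable_pi_lambda _ _ _ (_) _ _ fun r => ?_
    obtain ⟨i, hi⟩ := htF r (Finset.mem_insert_of_mem (Finset.mem_insert_of_mem
      (Finset.mem_union_left _ (Finset.mem_image_of_mem _ r.2))))
    have hmin : t (min i k) = r := by
      rw [ht.map_min, hi, hk]
      exact min_eq_left r.1.2
    have := hincr (Iio k) 0 (min i k) (Nat.zero_le _)
      fun i _ hi => hi.trans_le (min_le_right _ _)
    rw [hmin, ht0] at this
    simpa [hbot] using this

end Increments

/-! ### Right-continuity of the generated filtration -/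

namespace MarketModel

variable {Ω : Type*} [mΩ : MeasurableSpace Ω] {P : Measure Ω} {T : ℝ} {p d : ℕ} [NeZero d]

theorem measurable_Y (M : MarketModel P T p d) (t : Icc (0 : ℝ) T) : Measurable (M.Y t) :=
  (M.Y_adapted t).mono (M.filtration.le t) le_rfl

theorem le_filtration_of_null (M : MarketModel P T p d) (hgen : M.IsGenerated)
    (t : Icc (0 : ℝ) T) {A : Set Ω} (hA : MeasurableSet A) (hPA : P A = 0) :
    MeasurableSet[M.filtration t] A := by
  rw [hgen t]
  exact (le_sup_right : _ ≤ (⨆ s ≤ t, MeasurableSpace.comap (M.Y s) inferInstance) ⊔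
      MeasurableSpace.generateFrom {A : Set Ω | MeasurableSet A ∧ P A = 0}) _
    (MeasurableSpace.measurableSet_generateFrom ⟨hA, hPA⟩)

/-- As the null sets belong to the filtration, a change of an event on a null set does not affect
its membership. -/
theorem measurableSet_filtration_of_ae_eq (M : MarketModel P T p d) (hgen : M.IsGenerated)
    (t : Icc (0 : ℝ) T) {A B : Set Ω} (hA : MeasurableSet A) (hB : MeasurableSet[M.filtration t] B)
    (hAB : A =ᵐ[P] B) : MeasurableSet[M.filtration t] A := by
  have hBm := M.filtration.le t _ hB
  obtain ⟨h1, h2⟩ := ae_eq_set.1 hAB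
  have hd1 := M.le_filtration_of_null hgen t (hA.diff hBm) h1
  have hd2 := M.le_filtration_of_null hgen t (hBm.diff hA) h2
  have hAe : A = (B \ (B \ A)) ∪ (A \ B) := by
    ext ω
    by_cases h1 : ω ∈ A <;> by_cases h2 : ω ∈ B <;> simp [h1, h2]
  rw [hAe]
  exact MeasurableSet.union (MeasurableSet.diff hB hd2) hd1

theorem filtration_le_eventuallyMeasurableSpace (M : MarketModel P T p d) (hgen : M.IsGenerated)
    (t : Icc (0 : ℝ) T) :
    M.filtration t ≤ eventuallyMeasurableSpace
      (⨆ s ≤ t, MeasurableSpace.comap (M.Y s) inferInstance) (ae P) := by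
  rw [hgen t]
  refine sup_le le_eventuallyMeasurableSpace (MeasurableSpace.generateFrom_le ?_)
  rintro A ⟨-, hPA⟩
  exact ⟨∅, @MeasurableSet.empty _ (_), ae_eq_empty.2 hPA⟩

/-- The σ-algebra generated by the increments of `Y` after time `s`. -/
@[reducible] def futureIncrements (M : MarketModel P T p d) (s : Icc (0 : ℝ) T) :
    MeasurableSpace Ω :=
  ⨆ u : Ici s, MeasurableSpace.comap (fun ω => M.Y u ω - M.Y s ω) inferInstance

theorem futureIncrements_le (M : MarketModel P T p d) (s : Icc (0 : ℝ) T) :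
    M.futureIncrements s ≤ mΩ :=
  iSup_le fun u => ((M.measurable_Y u).sub (M.measurable_Y s)).comap_le

theorem measurable_increment (M : MarketModel P T p d) {s u : Icc (0 : ℝ) T} (hsu : s ≤ u) :
    Measurable[M.futureIncrements s] fun ω => M.Y u ω - M.Y s ω :=
  (comap_measurable _).mono (le_iSup_of_le (⟨u, hsu⟩ : Ici s) le_rfl) le_rfl

theorem antitone_futureIncrements (M : MarketModel P T p d) : Antitone M.futureIncrements := by
  intro s t hst
  refine iSup_le fun u => Measurable.comap_le ?_
  convert (M.measurable_increment (hst.trans u.2)).sub (M.measurable_increment hst) using 1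
  ext ω
  simp

theorem indep_filtration_futureIncrements [IsProbabilityMeasure P] (M : MarketModel P T p d)
    (hgen : M.IsGenerated) (hH : M.IndependentIncrements) (s : Icc (0 : ℝ) T) :
    Indep (M.filtration s) (M.futureIncrements s) P := by
  have hm : ∀ t : WithBot (Icc (0 : ℝ) T), Measurable
      (t.recBotCoe (fun _ => 0) M.Y : Ω → (Fin p → ℝ)) := by
    intro t
    induction t using WithBot.recBotCoe with
    | bot => exact measurable_const
    | coe t => exact M.measurable_Y t
  have h := hH.indepFun_past_future hm (fun ω => rfl) (s : WithBot (Icc (0 : ℝ) T))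
  rw [IndepFun_iff_Indep] at h
  refine Indep.of_le_eventuallyMeasurableSpace ?_ (M.filtration_le_eventuallyMeasurableSpace hgen s)
  refine indep_of_indep_of_le_left (indep_of_indep_of_le_right h ?_) ?_
  · refine iSup_le fun u => ?_
    rintro _ ⟨B, hB, rfl⟩
    exact ⟨(fun f => f ⟨(u : Icc (0 : ℝ) T), WithBot.coe_le_coe.2 u.2⟩) ⁻¹' B,
      measurable_pi_apply _ hB, rfl⟩
  · refine iSup₂_le fun r hr => ?_
    rintro _ ⟨B, hB, rfl⟩
    exact ⟨(fun f => f ⟨(r : WithBot (Icc (0 : ℝ) T)), WithBot.coe_le_coe.2 hr⟩) ⁻¹' B,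
      measurable_pi_apply _ hB, rfl⟩

/-- The σ-algebra generated by the increments of `Y` between times strictly after `t`. -/
@[reducible] def strictFutureIncrements (M : MarketModel P T p d) (t : Icc (0 : ℝ) T) :
    MeasurableSpace Ω :=
  ⨆ s : Ioi t, M.futureIncrements s

theorem strictFutureIncrements_le (M : MarketModel P T p d) (t : Icc (0 : ℝ) T) :
    M.strictFutureIncrements t ≤ mΩ :=
  iSup_le fun _ => M.futureIncrements_le _

theorem indep_iInf_filtration_strictFutureIncrements [IsProbabilityMeasure P]
    (M : MarketModel P T p d) (hgen : M.IsGenerated) (hH : M.IndependentIncrements)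
    {t : Icc (0 : ℝ) T} (ht : ¬ IsMax t) :
    Indep (⨅ s > t, M.filtration s : MeasurableSpace Ω) (M.strictFutureIncrements t) P := by
  obtain ⟨q, hq⟩ := not_isMax_iff.1 ht
  refine (indep_iSup_of_antitone (fun s : Ioi t => ?_) (fun s => M.futureIncrements_le _)
    ((iInf₂_le q hq).trans (M.filtration.le q))
    (fun r s hrs => M.antitone_futureIncrements hrs)).symm
  exact (indep_of_indep_of_le_left (M.indep_filtration_futureIncrements hgen hH s)
    (iInf₂_le _ s.2)).symm

/-- By right-continuity of the paths, an increment after `t` is a limit of increments that start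
strictly after `t`. -/
theorem measurable_increment_strictFutureIncrements (M : MarketModel P T p d)
    {t u : Icc (0 : ℝ) T} (hu : t < u) :
    Measurable[M.strictFutureIncrements t] fun ω => M.Y u ω - M.Y t ω := by
  obtain ⟨s, hs, hst, hslim⟩ := exists_seq_strictAnti_tendsto' hu
  refine @measurable_of_tendsto_metrizable _ _ (M.strictFutureIncrements t) _ _ _ _
    (fun n ω => M.Y u ω - M.Y (s n) ω) _ (fun n => ?_) ?_
  · exact (M.measurable_increment (hst n).2.le).mono
      (le_iSup_of_le (⟨s n, (hst n).1⟩ : Ioi t) le_rfl) le_rfl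
  · refine tendsto_pi_nhds.2 fun ω => Tendsto.const_sub _ ?_
    exact (M.Y_rcll ω t).1.tendsto.comp (tendsto_nhdsWithin_iff.2
      ⟨hslim, Eventually.of_forall fun n => (hst n).1.le⟩)

theorem measurable_Y_past_sup_future (M : MarketModel P T p d) (t u : Icc (0 : ℝ) T) :
    Measurable[(⨆ s ≤ t, MeasurableSpace.comap (M.Y s) inferInstance) ⊔
      M.strictFutureIncrements t] (M.Y u) := by
  have hpast : ∀ r ≤ t, Measurable[(⨆ s ≤ t, MeasurableSpace.comap (M.Y s) inferInstance) ⊔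
      M.strictFutureIncrements t] (M.Y r) := fun r hr =>
    (comap_measurable _).mono (le_sup_of_le_left (le_iSup₂_of_le r hr le_rfl)) le_rfl
  rcases le_or_gt u t with hu | hu
  · exact hpast u hu
  · convert ((M.measurable_increment_strictFutureIncrements hu).mono le_sup_right le_rfl).add
      (hpast t le_rfl) using 1
    ext ω
    simp

/-- The filtration generated by a right-continuous process with independent increments and the null
sets is right-continuous: an event known immediately after `t` is independent of all the increments
after `t`, and it is a function of these and of the path up to `t`. -/
theorem iInf_filtration_le [IsProbabilityMeasure P] (M : MarketModel P T p d)
    (hgen : M.IsGenerated) (hH : M.IndependentIncrements) {t : Icc (0 : ℝ) T} (ht : ¬ IsMax t) :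
    (⨅ s > t, M.filtration s : MeasurableSpace Ω) ≤ M.filtration t := by
  obtain ⟨q, hq⟩ := not_isMax_iff.1 ht
  have hleq : (⨅ s > t, M.filtration s : MeasurableSpace Ω) ≤ M.filtration q := iInf₂_le q hq
  have hpast : (⨆ s ≤ t, MeasurableSpace.comap (M.Y s) inferInstance) ≤ M.filtration t := by
    rw [hgen t]
    exact le_sup_left
  have hall : (⨆ s ≤ q, MeasurableSpace.comap (M.Y s) inferInstance) ≤
      (⨆ s ≤ t, MeasurableSpace.comap (M.Y s) inferInstance) ⊔ M.strictFutureIncrements t :=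
    iSup₂_le fun u _ => (M.measurable_Y_past_sup_future t u).comap_le
  have hpast' := hpast.trans (le_iInf₂ fun s (hs : s > t) => M.filtration.mono (le_of_lt hs))
  intro A hA
  have hAq := hleq A hA
  obtain ⟨A', hA', hAA'⟩ := M.filtration_le_eventuallyMeasurableSpace hgen q A hAq
  have hA'' : MeasurableSet[eventuallyMeasurableSpace
      ((⨆ s ≤ t, MeasurableSpace.comap (M.Y s) inferInstance) ⊔ M.strictFutureIncrements t)
      (ae P)] A := ⟨A', hall A' hA', hAA'⟩
  obtain ⟨B, hB, hAB⟩ := exists_measurableSet_ae_eq_of_indep hpast'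
    (hleq.trans (M.filtration.le q)) (M.strictFutureIncrements_le t)
    (M.indep_iInf_filtration_strictFutureIncrements hgen hH ht) hA hA''
  exact M.measurableSet_filtration_of_ae_eq hgen t (M.filtration.le q A hAq) (hpast B hB) hAB

end MarketModel

/-! ### Freezing an independent variable -/

section Freezing

theorem lintegral_comp_prodMk_of_indepFun {Ω Ω' : Type*} {mΩ' : MeasurableSpace Ω'}
    [MeasurableSpace Ω] {P : Measure Ω} [IsFiniteMeasure P] {X : Ω → Ω'} (hX : Measurable X)
    {ξ : Ω → ℝ} (hξ : Measurable ξ) (hind : IndepFun X ξ P) {h : Ω' × ℝ → ENNReal}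
    (hh : Measurable h) :
    ∫⁻ ω, h (X ω, ξ ω) ∂P = ∫⁻ z, ∫⁻ ω, h (X ω, z) ∂P ∂(P.map ξ) := by
  have hmap := (indepFun_iff_map_prod_eq_prod_map_map hX.aemeasurable hξ.aemeasurable).1 hind
  rw [← lintegral_map (f := h) hh (hX.prodMk hξ), hmap, lintegral_prod_symm' _ hh]
  exact lintegral_congr fun z => lintegral_map (hh.comp measurable_prodMk_right) hX

variable {Ω : Type*} {m : MeasurableSpace Ω} [mΩ : MeasurableSpace Ω] {P : Measure Ω}
  [IsProbabilityMeasure P] {ξ : Ω → ℝ}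

/-- Fubini's theorem for a function of `ω` and of a random variable `ξ`, where the dependence on `ω`
is through a σ-algebra `m` independent of `ξ`. -/
theorem lintegral_comp_prodMk_of_indep (hm : m ≤ mΩ) (hξ : Measurable ξ)
    (hind : Indep m (MeasurableSpace.comap ξ inferInstance) P) {h : Ω × ℝ → ENNReal}
    (hh : Measurable[m.prod inferInstance] h) :
    ∫⁻ ω, h (ω, ξ ω) ∂P = ∫⁻ z, ∫⁻ ω, h (ω, z) ∂P ∂(P.map ξ) := by
  refine lintegral_comp_prodMk_of_indepFun (mΩ' := m) (X := id) hm hξ ?_ hh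
  change Indep (MeasurableSpace.comap id m) _ P
  rw [MeasurableSpace.comap_id]
  exact hind

theorem prod_le_prod_of_le (hm : m ≤ mΩ) :
    (m.prod inferInstance : MeasurableSpace (Ω × ℝ)) ≤ mΩ.prod inferInstance :=
  sup_le_sup_right (MeasurableSpace.comap_mono hm) _

theorem measurable_lintegral_of_prod (hm : m ≤ mΩ) {h : Ω × ℝ → ENNReal}
    (hh : Measurable[m.prod inferInstance] h) : Measurable fun z => ∫⁻ ω, h (ω, z) ∂P :=
  (hh.mono (prod_le_prod_of_le hm) le_rfl : Measurable h).lintegral_prod_left'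

theorem ae_ae_of_ae_prodMk_of_indep (hm : m ≤ mΩ) (hξ : Measurable ξ)
    (hind : Indep m (MeasurableSpace.comap ξ inferInstance) P) {A : Set (Ω × ℝ)}
    (hA : MeasurableSet[m.prod inferInstance] A) (hAξ : ∀ᵐ ω ∂P, (ω, ξ ω) ∈ A) :
    ∀ᵐ z ∂(P.map ξ), ∀ᵐ ω ∂P, (ω, z) ∈ A := by
  have hh : Measurable[m.prod inferInstance] (Aᶜ.indicator (1 : Ω × ℝ → ENNReal)) :=
    @Measurable.indicator _ _ (_) _ _ _ _ (@measurable_const _ _ _ (_) 1)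
      (@MeasurableSet.compl _ _ (_) hA)
  have h0 : ∫⁻ ω, Aᶜ.indicator (1 : Ω × ℝ → ENNReal) (ω, ξ ω) ∂P = 0 := by
    rw [lintegral_congr_ae (g := 0), Pi.zero_def, lintegral_zero]
    filter_upwards [hAξ] with ω hω
    simp [hω]
  rw [lintegral_comp_prodMk_of_indep hm hξ hind hh,
    lintegral_eq_zero_iff (measurable_lintegral_of_prod hm hh)] at h0
  filter_upwards [h0] with z hz
  have hzm : Measurable fun ω => Aᶜ.indicator (1 : Ω × ℝ → ENNReal) (ω, z) :=
    (hh.mono (prod_le_prod_of_le hm) le_rfl).comp measurable_prodMk_right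
  filter_upwards [(lintegral_eq_zero_iff hzm).1 hz] with ω hω
  by_contra hn
  simp [hn] at hω

end Freezing

/-! ### Expectations of extended real variables -/

theorem coe_sub_coe_le_coe_iff {a b : ENNReal} (hb : b ≠ ⊤) (r : ℝ) :
    (a : EReal) - b ≤ r ↔ a + ENNReal.ofReal (-r) ≤ b + ENNReal.ofReal r := by
  lift b to NNReal using hb
  induction a with
  | top =>
    have h2 : (b : ENNReal) + ENNReal.ofReal r ≠ ⊤ := by finiteness
    simp [h2]
  | coe a =>
    have h1 : (((a : ENNReal) : EReal) - ((b : ENNReal) : EReal) ≤ r) ↔ (a : ℝ) - b ≤ r := by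
      rw [← EReal.coe_le_coe_iff]; rfl
    have h2 : ((a : ENNReal) + ENNReal.ofReal (-r) ≤ b + ENNReal.ofReal r) ↔
        (a : ℝ) + max (-r) 0 ≤ b + max r 0 := by
      rw [ENNReal.ofReal, ENNReal.ofReal, ← ENNReal.coe_add, ← ENNReal.coe_add, ENNReal.coe_le_coe,
        ← NNReal.coe_le_coe, NNReal.coe_add, NNReal.coe_add, Real.coe_toNNReal', Real.coe_toNNReal']
    rw [h1, h2]
    rcases le_total 0 r with hr | hr
    · rw [max_eq_right (by linarith), max_eq_left hr]; constructor <;> intro h <;> linarith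
    · rw [max_eq_left (by linarith), max_eq_right hr]; constructor <;> intro h <;> linarith

/-- An average of differences is at most any common bound of these differences, also with the
convention `⊤ - ⊤ = ⊥`. -/
theorem lintegral_sub_lintegral_le {α : Type*} [MeasurableSpace α] {μ : Measure α}
    [IsProbabilityMeasure μ] {a b : α → ENNReal} (ha : Measurable a) (hb : Measurable b) {c : EReal}
    (h : ∀ᵐ z ∂μ, (a z : EReal) - b z ≤ c) :
    ((∫⁻ z, a z ∂μ : ENNReal) : EReal) - (∫⁻ z, b z ∂μ : ENNReal) ≤ c := by
  by_cases hbt : ∫⁻ z, b z ∂μ = ⊤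
  · rw [hbt, EReal.coe_ennreal_top, EReal.sub_top]
    exact bot_le
  have hbf : ∀ᵐ z ∂μ, b z < ⊤ := ae_lt_top hb hbt
  induction c with
  | top => exact le_top
  | bot =>
    obtain ⟨z, hz, hzb⟩ := (h.and hbf).exists
    rw [le_bot_iff] at hz
    exfalso
    have h1 := (coe_sub_coe_le_coe_iff (a := a z) hzb.ne (-(b z).toReal - 1)).1
      (hz ▸ bot_le)
    have h2 : ENNReal.ofReal (-(b z).toReal - 1) = 0 :=
      ENNReal.ofReal_of_nonpos (by linarith [(b z).toReal_nonneg])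
    rw [h2, add_zero] at h1
    have h3 := ENNReal.toReal_mono hzb.ne (le_add_self.trans h1)
    rw [ENNReal.toReal_ofReal (by linarith [(b z).toReal_nonneg])] at h3
    linarith
  | coe r =>
    rw [coe_sub_coe_le_coe_iff hbt]
    have h1 : ∫⁻ z, (a z + ENNReal.ofReal (-r)) ∂μ ≤ ∫⁻ z, (b z + ENNReal.ofReal r) ∂μ := by
      refine lintegral_mono_ae ?_
      filter_upwards [h, hbf] with z hz hzb
      exact (coe_sub_coe_le_coe_iff hzb.ne r).1 hz
    rwa [lintegral_add_left ha, lintegral_add_left hb, lintegral_const, lintegral_const,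
      measure_univ, mul_one, mul_one] at h1

theorem measurable_ite_mem_bot {E : Type*} [MeasurableSpace E] {s : Set E} [DecidablePred (· ∈ s)]
    (hs : MeasurableSet s) {U : E → EReal} (hU : Measurable fun z : s => U z) :
    Measurable fun z => if z ∈ s then U z else ⊥ := by
  refine measurable_of_restrict_of_restrict_compl hs ?_ ?_
  · convert hU using 1
    ext z
    simp
  · convert measurable_const (a := (⊥ : EReal)) using 1
    ext z
    have : (z : E) ∉ s := z.2
    simp [this]

/-! ### Wealth as a function of the path -/

section PathWealth

variable {T : ℝ} {d : ℕ}

/-- The wealth at time `t` that results from one price path `σ` and one path `β` of trades; `o` is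
the initial time. -/
def pathWealth (x : Fin d → ℝ) (σ β : Icc (0 : ℝ) T → (Fin d → ℝ)) (o t : Icc (0 : ℝ) T) :
    Fin d → ℝ :=
  fun j => σ t j * (x j + (1 / σ o j * β o j +
    rsIntegral (fun s => 1 / σ s j) (fun s => β s j) o t))

variable {x : Fin d → ℝ} {σ β : Icc (0 : ℝ) T → (Fin d → ℝ)} {o : Icc (0 : ℝ) T}
  {K : ConvexCone ℝ (Fin d → ℝ)} {l : (Fin d → ℝ) →L[ℝ] ℝ}

theorem exists_hasRSIntegral_of_decreasing (hl : ∀ v ∈ K, ‖v‖ ≤ l v)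
    (hσ : Continuous σ) (hσ0 : ∀ t j, 0 < σ t j)
    (hβ : ∀ s t, s ≤ t → β s - β t ∈ K) (hβc : ∀ t, ContinuousWithinAt β (Ici t) t) (j : Fin d) :
    ∃ I : Icc (0 : ℝ) T → ℝ,
      (∀ b, HasRSIntegral (fun s => 1 / σ s j) (fun s => β s j) o b (I b)) ∧
      ∀ t, o ≤ t → ContinuousWithinAt I (Ici t) t := by
  refine exists_hasRSIntegral (φ := fun t => -l (β t)) ?_ ?_ ?_ ?_ o
  · exact continuous_const.div ((continuous_apply j).comp hσ) fun t => (hσ0 t j).ne'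
  · exact fun t => ((continuous_apply j).continuousAt).comp_continuousWithinAt (hβc t)
  · exact fun t => (l.continuous.continuousAt.comp_continuousWithinAt (hβc t)).neg
  · intro s t hst
    have h1 := hl _ (hβ s t hst)
    have h2 := norm_le_pi_norm (β s - β t) j
    rw [Pi.sub_apply, Real.norm_eq_abs, abs_sub_comm] at h2
    rw [map_sub] at h1
    linarith

theorem continuousWithinAt_pathWealth (hl : ∀ v ∈ K, ‖v‖ ≤ l v)
    (hσ : Continuous σ) (hσ0 : ∀ t j, 0 < σ t j)
    (hβ : ∀ s t, s ≤ t → β s - β t ∈ K) (hβc : ∀ t, ContinuousWithinAt β (Ici t) t)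
    {t : Icc (0 : ℝ) T} (ht : o ≤ t) :
    ContinuousWithinAt (pathWealth x σ β o) (Ici t) t := by
  refine continuousWithinAt_pi.2 fun j => ?_
  obtain ⟨I, hI, hIc⟩ := exists_hasRSIntegral_of_decreasing (o := o) hl hσ hσ0 hβ hβc j
  have hσj : ContinuousWithinAt (fun t => σ t j) (Ici t) t :=
    ((continuous_apply j).comp hσ).continuousWithinAt
  refine (hσj.mul (continuousWithinAt_const.add (continuousWithinAt_const.add
    (hIc t ht)))).congr (f := fun b => σ b j * (x j + (1 / σ o j * β o j + I b))) ?_ ?_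
  · intro b hb
    rw [pathWealth, (hI b).rsIntegral_eq (ht.trans hb)]
  · rw [pathWealth, (hI t).rsIntegral_eq ht]

theorem measurable_pathWealth {α : Type*} [MeasurableSpace α]
    {σ β : Icc (0 : ℝ) T → α → (Fin d → ℝ)} (hl : ∀ v ∈ K, ‖v‖ ≤ l v)
    (hσ : ∀ y, Continuous fun t => σ t y) (hσ0 : ∀ t y j, 0 < σ t y j)
    (hβ : ∀ y s t, s ≤ t → β s y - β t y ∈ K)
    (hβc : ∀ y t, ContinuousWithinAt (fun s => β s y) (Ici t) t)
    (hσm : ∀ t, Measurable (σ t)) (hβm : ∀ t, Measurable (β t)) {t : Icc (0 : ℝ) T}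
    (ht : o ≤ t) :
    Measurable fun y => pathWealth x (fun s => σ s y) (fun s => β s y) o t := by
  refine measurable_pi_lambda _ fun j => ?_
  have hσj : ∀ t, Measurable fun y => σ t y j := fun t => (measurable_pi_apply j).comp (hσm t)
  have hβj : ∀ t, Measurable fun y => β t y j := fun t => (measurable_pi_apply j).comp (hβm t)
  refine (hσj t).mul (measurable_const.add ((((measurable_const).div (hσj o)).mul (hβj o)).add ?_))
  refine measurable_of_tendsto_metrizable
    (f := fun n y => uniformSum (fun s => 1 / σ s y j) (fun s => β s y j) o t n) (fun n => ?_)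
    (tendsto_pi_nhds.2 fun y => ?_)
  · exact Finset.measurable_sum _ fun i _ =>
      (measurable_const.div (hσj _)).mul ((hβj _).sub (hβj _))
  · obtain ⟨I, hI, -⟩ := exists_hasRSIntegral_of_decreasing (o := o) hl (hσ y)
      (fun t => hσ0 t y) (hβ y) (hβc y) j
    rw [(hI t).rsIntegral_eq ht]
    exact (hI t).tendsto_uniformSum ht

end PathWealth

/-! ### Regularization of a parametrized family of paths -/

section Regularization

variable {T : ℝ} {E α : Type*} [NormedAddCommGroup E] [NormedSpace ℝ E]

/-- The parameters for which the family `b`, observed at the times of `D`, is `K`-decreasing, also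
at the initial time `o`. -/
def decreasingSet (K : ConvexCone ℝ E) (D : Set (Icc (0 : ℝ) T)) (o : Icc (0 : ℝ) T)
    (b : Icc (0 : ℝ) T → α → E) : Set α :=
  {y | (∀ s ∈ D, ∀ t ∈ D, s ≤ t → b s y - b t y ∈ K) ∧ -(b o y) ∈ K}

open Classical in
/-- The right-continuous `K`-decreasing paths that a family `b` determines by its values at the
times of `D`; they are constant `0` for the parameters where `b` is not `K`-decreasing. -/
def regularize (K : ConvexCone ℝ E) (D : Set (Icc (0 : ℝ) T)) (o : Icc (0 : ℝ) T)
    (b : Icc (0 : ℝ) T → α → E) (t : Icc (0 : ℝ) T) (y : α) : E :=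
  if y ∈ decreasingSet K D o b then rightLimOn D (fun s => b s y) t else 0

variable [FiniteDimensional ℝ E] {K : ConvexCone ℝ E} {l : E →L[ℝ] ℝ}
  {D : Set (Icc (0 : ℝ) T)} {o : Icc (0 : ℝ) T} {b : Icc (0 : ℝ) T → α → E}

theorem regularize_sub_mem (hK : IsClosed (K : Set E)) (h0 : 0 ∈ K) (hl : ∀ v ∈ K, ‖v‖ ≤ l v)
    (hD : Dense D) (hoD : o ∈ D) (ho : ∀ t, o ≤ t) (hDmax : ∀ t, IsMax t → t ∈ D)
    (y : α) {s t : Icc (0 : ℝ) T} (hst : s ≤ t) :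
    regularize K D o b s y - regularize K D o b t y ∈ K := by
  by_cases hy : y ∈ decreasingSet K D o b
  · simp only [regularize, if_pos hy]
    exact rightLimOn_sub_rightLimOn_mem hK h0 hl hD ⟨o, hoD, ho⟩ hDmax hy.1 hst
  · simpa only [regularize, if_neg hy, sub_zero] using h0

theorem neg_regularize_mem (hK : IsClosed (K : Set E)) (h0 : 0 ∈ K) (hl : ∀ v ∈ K, ‖v‖ ≤ l v)
    (hD : Dense D) (hoD : o ∈ D) (ho : ∀ t, o ≤ t) (hDmax : ∀ t, IsMax t → t ∈ D) (y : α) :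
    -(regularize K D o b o y) ∈ K := by
  by_cases hy : y ∈ decreasingSet K D o b
  · simp only [regularize, if_pos hy]
    have h1 := K.add_mem (sub_rightLimOn_mem hK hl hD ⟨o, hoD, ho⟩ hDmax hy.1 hoD le_rfl) hy.2
    convert h1 using 1
    abel
  · simpa only [regularize, if_neg hy, neg_zero] using h0

theorem continuousWithinAt_regularize (hK : IsClosed (K : Set E)) (h0 : 0 ∈ K)
    (hl : ∀ v ∈ K, ‖v‖ ≤ l v)
    (hD : Dense D) (hoD : o ∈ D) (ho : ∀ t, o ≤ t) (hDmax : ∀ t, IsMax t → t ∈ D)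
    (y : α) (t : Icc (0 : ℝ) T) :
    ContinuousWithinAt (fun s => regularize K D o b s y) (Ici t) t := by
  by_cases hy : y ∈ decreasingSet K D o b
  · simp only [regularize, if_pos hy]
    exact continuousWithinAt_rightLimOn hK h0 hl hD ⟨o, hoD, ho⟩ hDmax hy.1 t
  · simp only [regularize, if_neg hy]
    exact continuousWithinAt_const

theorem exists_seq_tendsto_of_not_isMax (hD : Dense D) {t r : Icc (0 : ℝ) T} (htr : t < r) :
    ∃ u : ℕ → Icc (0 : ℝ) T, (∀ n, u n ∈ D ∧ t < u n ∧ u n < r) ∧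
      Tendsto u atTop (𝓝[D ∩ Ioi t] t) := by
  have := nhdsWithin_inter_Ioi_neBot hD (not_isMax_iff.2 ⟨r, htr⟩)
  obtain ⟨u, hu⟩ := exists_seq_tendsto (𝓝[D ∩ Ioi t] t)
  have hev : ∀ᶠ s in 𝓝[D ∩ Ioi t] t, s ∈ D ∧ t < s ∧ s < r := by
    filter_upwards [self_mem_nhdsWithin, nhdsWithin_le_nhds (Iio_mem_nhds htr)] with s hs hsr
    exact ⟨hs.1, hs.2, hsr⟩
  obtain ⟨N, hN⟩ := (hu.eventually hev).exists_forall_of_atTop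
  exact ⟨fun n => u (n + N), fun n => hN _ (Nat.le_add_left N n),
    hu.comp (tendsto_add_atTop_nat N)⟩

variable [MeasurableSpace E] [BorelSpace E]

theorem measurableSet_decreasingSet [SecondCountableTopology E] [MeasurableSpace α]
    (hK : IsClosed (K : Set E)) (hDc : D.Countable) (hb : ∀ t ∈ D, Measurable (b t))
    (hoD : o ∈ D) : MeasurableSet (decreasingSet K D o b) := by
  have hKm : MeasurableSet (K : Set E) := hK.measurableSet
  have : decreasingSet K D o b = (⋂ s ∈ D, ⋂ t ∈ D, ⋂ _ : s ≤ t, {y | b s y - b t y ∈ K}) ∩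
      {y | -(b o y) ∈ K} := by
    ext y
    simp only [decreasingSet, mem_inter_iff, mem_iInter, mem_ofPred_eq]
  rw [this]
  refine (MeasurableSet.biInter hDc fun s hs => MeasurableSet.biInter hDc fun t ht =>
    MeasurableSet.iInter fun _ => ?_).inter ?_
  · exact ((hb s hs).sub (hb t ht)) hKm
  · exact (hb o hoD).neg hKm

/-- The regularized path at `t` is a limit of the values of `b` at times of `D` before `r`, for
every `r > t`. -/
theorem measurable_regularize_of_lt {mα : MeasurableSpace α} (hl : ∀ v ∈ K, ‖v‖ ≤ l v)
    (hD : Dense D) (hoD : o ∈ D) (ho : ∀ t, o ≤ t) {t r : Icc (0 : ℝ) T} (htr : t < r)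
    (hs : MeasurableSet (decreasingSet K D o b)) (hb : ∀ s ∈ D, s < r → Measurable (b s)) :
    Measurable (regularize K D o b t) := by
  obtain ⟨u, hu, hlim⟩ := exists_seq_tendsto_of_not_isMax hD htr
  refine measurable_of_tendsto_metrizable
    (f := fun n => (decreasingSet K D o b).indicator (b (u n)))
    (fun n => (hb _ (hu n).1 (hu n).2.2).indicator hs) (tendsto_pi_nhds.2 fun y => ?_)
  by_cases hy : y ∈ decreasingSet K D o b
  · simp only [regularize, if_pos hy, indicator_of_mem hy]
    exact (tendsto_rightLimOn hl hD ⟨o, hoD, ho⟩ hy.1 (not_isMax_iff.2 ⟨r, htr⟩)).comp hlim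
  · simp only [regularize, if_neg hy, indicator_of_notMem hy]
    exact tendsto_const_nhds

theorem measurable_regularize_of_isMax {mα : MeasurableSpace α} {t : Icc (0 : ℝ) T} (ht : IsMax t)
    (hs : MeasurableSet (decreasingSet K D o b)) (hb : Measurable (b t)) :
    Measurable (regularize K D o b t) := by
  have : regularize K D o b t = (decreasingSet K D o b).indicator (b t) := by
    ext y
    by_cases hy : y ∈ decreasingSet K D o b
    · simp only [regularize, if_pos hy, indicator_of_mem hy, rightLimOn_of_isMax D _ ht]
    · simp only [regularize, if_neg hy, indicator_of_notMem hy]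
  rw [this]
  exact hb.indicator hs

end Regularization

/-! ### Strategies with frozen randomization -/

namespace MarketModel

variable {Ω : Type*} [mΩ : MeasurableSpace Ω] {P : Measure Ω} {T : ℝ} {p d : ℕ} [NeZero d]

theorem start_le (M : MarketModel P T p d) (t : Icc (0 : ℝ) T) : M.start ≤ t := t.2.1

theorem le_horizon (M : MarketModel P T p d) (t : Icc (0 : ℝ) T) : t ≤ M.horizon := t.2.2

theorem eq_horizon_of_isMax (M : MarketModel P T p d) {t : Icc (0 : ℝ) T} (ht : IsMax t) :
    t = M.horizon :=
  ht.eq_of_le (M.le_horizon t)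

/-- All the information of `𝓕_T` comes from `Y`, up to null sets, so it is independent of `ξ`. -/
theorem indep_filtration_comap (M : MarketModel P T p d) (hgen : M.IsGenerated) {ξ : Ω → ℝ}
    (hind : IndepFun (fun ω t => M.Y t ω) ξ P) (t : Icc (0 : ℝ) T) :
    Indep (M.filtration t) (MeasurableSpace.comap ξ inferInstance) P := by
  rw [IndepFun_iff_Indep] at hind
  refine Indep.of_le_eventuallyMeasurableSpace (indep_of_indep_of_le_left hind ?_)
    (M.filtration_le_eventuallyMeasurableSpace hgen t)
  refine iSup₂_le fun s _ => ?_
  rintro _ ⟨A, hA, rfl⟩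
  exact ⟨(fun f => f s) ⁻¹' A, measurable_pi_apply s hA, rfl⟩

theorem exists_measurable_enlarge (M : MarketModel P T p d) {ξ : Ω → ℝ} (hξ : Measurable ξ)
    {E : Type*} [MeasurableSpace E] [StandardBorelSpace E] [Nonempty E] {t : Icc (0 : ℝ) T}
    {f : Ω → E} (hf : Measurable[(M.enlarge ξ hξ).filtration t] f) :
    ∃ b : Ω × ℝ → E, Measurable[(M.filtration t).prod inferInstance] b ∧
      ∀ ω, b (ω, ξ ω) = f ω := by
  have heq : (M.enlarge ξ hξ).filtration t =
      MeasurableSpace.comap (fun ω => (ω, ξ ω)) ((M.filtration t).prod inferInstance) := by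
    change M.filtration t ⊔ MeasurableSpace.comap ξ inferInstance = _
    rw [MeasurableSpace.prod, MeasurableSpace.comap_sup, MeasurableSpace.comap_comp,
      MeasurableSpace.comap_comp]
    exact congrArg (· ⊔ MeasurableSpace.comap ξ inferInstance)
      (MeasurableSpace.comap_id (m := M.filtration t)).symm
  rw [heq] at hf
  obtain ⟨b, hb, hfb⟩ := Measurable.exists_eq_measurable_comp
    (mY := (M.filtration t).prod inferInstance) hf
  exact ⟨b, hb, fun ω => (congrFun hfb ω).symm⟩

theorem le_bellman (M : MarketModel P T p d) {K : ConvexCone ℝ (Fin d → ℝ)}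
    (U : (Fin d → ℝ) → EReal) {x : Fin d → ℝ} {B : Icc (0 : ℝ) T → Ω → (Fin d → ℝ)}
    (hB : B ∈ M.admissible K x) :
    expectation P (fun ω => U (M.wealth x B M.horizon ω)) ≤ M.bellman K U x :=
  le_iSup₂_of_le B hB le_rfl

/-- Every strategy of the smaller model is a strategy of the enlarged one. -/
theorem bellman_le_bellman_enlarge (M : MarketModel P T p d) {ξ : Ω → ℝ} (hξ : Measurable ξ)
    (K : ConvexCone ℝ (Fin d → ℝ)) (U : (Fin d → ℝ) → EReal) (x : Fin d → ℝ) :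
    M.bellman K U x ≤ (M.enlarge ξ hξ).bellman K U x := by
  refine iSup₂_le fun B hB => (M.enlarge ξ hξ).le_bellman U (x := x) (B := B) ⟨?_, hB.2⟩
  exact ⟨fun t => (hB.1.adapted t).mono le_sup_left le_rfl, hB.1.rcll, hB.1.decreasing,
    hB.1.start_mem⟩

variable [IsProbabilityMeasure P] {K : ConvexCone ℝ (Fin d → ℝ)} {l : (Fin d → ℝ) →L[ℝ] ℝ}
  {D : Set (Icc (0 : ℝ) T)} {b : Icc (0 : ℝ) T → Ω × ℝ → (Fin d → ℝ)}

/-- For a value `z` of the randomization for which the section of the family `b` is almost surely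
`K`-decreasing, the regularized section is a strategy of the original model. Adaptedness rests on
the right-continuity of the filtration, because the regularization looks into the immediate
future. -/
theorem isStrategy_regularize (M : MarketModel P T p d) (hgen : M.IsGenerated)
    (hH : M.IndependentIncrements) (hK : IsClosed (K : Set (Fin d → ℝ))) (h0 : 0 ∈ K)
    (hl : ∀ v ∈ K, ‖v‖ ≤ l v) (hDc : D.Countable) (hD : Dense D) (hoD : M.start ∈ D)
    (hTD : M.horizon ∈ D)
    (hb : ∀ t, Measurable[(M.filtration t).prod inferInstance] (b t)) {z : ℝ}
    (hz : ∀ᵐ ω ∂P, (ω, z) ∈ decreasingSet K D M.start b) :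
    M.IsStrategy K fun t ω => regularize K D M.start b t (ω, z) := by
  have hmax : ∀ t : Icc (0 : ℝ) T, IsMax t → t ∈ D := fun t ht => M.eq_horizon_of_isMax ht ▸ hTD
  have hdec : ∀ ω (s t : Icc (0 : ℝ) T), s ≤ t →
      regularize K D M.start b s (ω, z) - regularize K D M.start b t (ω, z) ∈ K :=
    fun ω s t hst => regularize_sub_mem hK h0 hl hD hoD M.start_le hmax (ω, z) hst
  let c : Icc (0 : ℝ) T → Ω → (Fin d → ℝ) := fun t ω => b t (ω, z)
  have hc : ∀ t, Measurable[M.filtration t] (c t) := fun t =>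
    (hb t).comp (@measurable_prodMk_right _ _ (M.filtration t) _ z)
  have hcm : ∀ t, Measurable (c t) := fun t => (hc t).mono (M.filtration.le t) le_rfl
  have hset : ∀ t, MeasurableSet[M.filtration t] (decreasingSet K D M.start c) := fun t =>
    M.measurableSet_filtration_of_ae_eq hgen t
      (measurableSet_decreasingSet hK hDc (fun t _ => hcm t) hoD) MeasurableSet.univ
      (eventuallyEq_univ.2 hz)
  refine ⟨fun t => ?_, fun ω t => ⟨?_, ?_⟩, fun ω s t hst => ?_, fun ω => ?_⟩
  · change Measurable[M.filtration t] (regularize K D M.start c t)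
    by_cases ht : IsMax t
    · exact measurable_regularize_of_isMax ht (hset t) (hc t)
    · refine Measurable.mono (ma := ⨅ s > t, M.filtration s) ?_
        (M.iInf_filtration_le hgen hH ht) le_rfl
      intro A hA
      rw [MeasurableSpace.measurableSet_iInf]
      intro r
      rw [MeasurableSpace.measurableSet_iInf]
      intro hr
      exact measurable_regularize_of_lt (mα := M.filtration r) hl hD hoD M.start_le hr (hset r)
        (fun s _ hsr => (hc s).mono (M.filtration.mono hsr.le) le_rfl) hA
  · exact continuousWithinAt_regularize hK h0 hl hD hoD M.start_le hmax (ω, z) t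
  · exact exists_tendsto_nhdsLT hl (hdec ω) t
  · rw [neg_sub]
    exact hdec ω s t hst
  · exact neg_regularize_mem hK h0 hl hD hoD M.start_le hmax (ω, z)

/-- An admissible strategy of the enlarged model does not outperform the value of the original
model: its expected utility is an average, over the values of `ξ`, of the expected utilities of the
strategies obtained by freezing `ξ`, and these are admissible in the original model. -/
theorem expectation_le_bellman (M : MarketModel P T p d) (hgen : M.IsGenerated)
    (hH : M.IndependentIncrements) (hK : IsClosed (K : Set (Fin d → ℝ)))
    (hKproper : (K : Set (Fin d → ℝ)) ∩ {z | -z ∈ K} = {0}) {U : (Fin d → ℝ) → EReal}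
    (hU : Measurable fun z : (K : Set (Fin d → ℝ)) => U z) {ξ : Ω → ℝ} (hξ : Measurable ξ)
    (hind : IndepFun (fun ω t => M.Y t ω) ξ P) {x : Fin d → ℝ}
    {B : Icc (0 : ℝ) T → Ω → (Fin d → ℝ)} (hB : B ∈ (M.enlarge ξ hξ).admissible K x) :
    expectation P (fun ω => U (M.wealth x B M.horizon ω)) ≤ M.bellman K U x := by
  classical
  have h0 : (0 : Fin d → ℝ) ∈ K := by
    have : (0 : Fin d → ℝ) ∈ (K : Set (Fin d → ℝ)) ∩ {z | -z ∈ K} := by rw [hKproper]; rfl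
    exact this.1
  obtain ⟨l, hl⟩ := exists_norm_le_clm_of_salient K hK hKproper
  obtain ⟨D₀, hD₀c, hD₀⟩ := TopologicalSpace.exists_countable_dense (Icc (0 : ℝ) T)
  set D : Set (Icc (0 : ℝ) T) := insert M.start (insert M.horizon D₀) with hDdef
  have hDc : D.Countable := (hD₀c.insert _).insert _
  have hD : Dense D := hD₀.mono ((subset_insert _ _).trans (subset_insert _ _))
  have hoD : M.start ∈ D := mem_insert _ _
  have hTD : M.horizon ∈ D := mem_insert_of_mem _ (mem_insert _ _)
  have hmax : ∀ t : Icc (0 : ℝ) T, IsMax t → t ∈ D := fun t ht => M.eq_horizon_of_isMax ht ▸ hTD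
  choose b hb hbB using fun t => M.exists_measurable_enlarge hξ (hB.1.adapted t)
  let 𝓜 : MeasurableSpace (Ω × ℝ) := (M.filtration M.horizon).prod inferInstance
  have hFle : ∀ t, M.filtration t ≤ M.filtration M.horizon := fun t =>
    M.filtration.mono (M.le_horizon t)
  have hbT : ∀ t, Measurable[𝓜] (b t) := fun t =>
    (hb t).mono (sup_le_sup_right (MeasurableSpace.comap_mono (hFle t)) _) le_rfl
  have hdecm : MeasurableSet[𝓜] (decreasingSet K D M.start b) :=
    @measurableSet_decreasingSet _ _ _ _ _ _ _ _ _ _ _ _ _ 𝓜 hK hDc (fun t _ => hbT t) hoD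
  have hdecξ : ∀ ω, (ω, ξ ω) ∈ decreasingSet K D M.start b := by
    intro ω
    simp only [decreasingSet, mem_ofPred_eq, hbB]
    refine ⟨fun s _ t _ hst => ?_, hB.1.start_mem ω⟩
    rw [← neg_sub]
    exact hB.1.decreasing ω s t hst
  set R := regularize K D M.start b with hR
  have hRm : ∀ t, Measurable[𝓜] (R t) := fun t => by
    by_cases ht : IsMax t
    · exact measurable_regularize_of_isMax (mα := 𝓜) ht hdecm (hbT t)
    · obtain ⟨r, hr⟩ := not_isMax_iff.1 ht
      exact measurable_regularize_of_lt (mα := 𝓜) hl hD hoD M.start_le hr hdecm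
        fun s _ _ => hbT s
  have hRdec : ∀ y (s t : Icc (0 : ℝ) T), s ≤ t → R s y - R t y ∈ K := fun y s t hst =>
    regularize_sub_mem hK h0 hl hD hoD M.start_le hmax y hst
  have hRc : ∀ y t, ContinuousWithinAt (fun s => R s y) (Ici t) t := fun y t =>
    continuousWithinAt_regularize hK h0 hl hD hoD M.start_le hmax y t
  -- Since `B` is right-continuous, evaluating the regularized family at `ξ` gives `B` back.
  have hRξ : ∀ ω t, R t (ω, ξ ω) = B t ω := by
    intro ω t
    rw [hR, regularize, if_pos (hdecξ ω)]
    simp only [hbB]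
    exact rightLimOn_eq_self hD (hB.1.rcll ω t).1
  let W : Icc (0 : ℝ) T → Ω × ℝ → (Fin d → ℝ) := fun t y =>
    pathWealth x (fun s => M.S s y.1) (fun s => R s y) M.start t
  have hWm : ∀ t, Measurable[𝓜] (W t) := fun t =>
    @measurable_pathWealth _ _ _ _ _ _ _ 𝓜 (fun s y => M.S s y.1) R hl
      (fun y => M.S_continuous y.1) (fun t y => M.S_pos t y.1) hRdec hRc
      (fun s => ((M.S_adapted s).mono (hFle s) le_rfl).comp
        (@measurable_fst _ _ (M.filtration M.horizon) _)) hRm _ (M.start_le t)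
  have hWξ : ∀ ω t, W t (ω, ξ ω) = M.wealth x B t ω := fun ω t => by
    simp only [W, hRξ]
    rfl
  have hm := M.filtration.le M.horizon
  have hindT := M.indep_filtration_comap hgen hind M.horizon
  have hgood₁ : ∀ᵐ z ∂(P.map ξ), ∀ᵐ ω ∂P, (ω, z) ∈ decreasingSet K D M.start b :=
    ae_ae_of_ae_prodMk_of_indep hm hξ hindT hdecm (ae_of_all _ hdecξ)
  have hgood₂ : ∀ᵐ z ∂(P.map ξ), ∀ t ∈ D, ∀ᵐ ω ∂P, W t (ω, z) ∈ K := by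
    rw [ae_ball_iff hDc]
    intro t _
    refine ae_ae_of_ae_prodMk_of_indep (A := W t ⁻¹' K) hm hξ hindT
      (hWm t hK.measurableSet) ?_
    filter_upwards [hB.2 t] with ω hω
    rw [mem_preimage, hWξ]
    exact hω
  -- The utility is measurable on the cone only, and the wealth leaves the cone on a null set.
  let U' : (Fin d → ℝ) → EReal := fun v => if v ∈ (K : Set (Fin d → ℝ)) then U v else ⊥
  have hU' : Measurable U' := measurable_ite_mem_bot hK.measurableSet hU
  have hpos : Measurable[𝓜] fun y => (U' (W M.horizon y)).toENNReal :=
    (measurable_ereal_toENNReal.comp hU').comp (hWm _)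
  have hneg : Measurable[𝓜] fun y => (-(U' (W M.horizon y))).toENNReal :=
    ((measurable_ereal_toENNReal.comp measurable_neg).comp hU').comp (hWm _)
  have hEB : expectation P (fun ω => U (M.wealth x B M.horizon ω)) =
      ((∫⁻ z, ∫⁻ ω, (U' (W M.horizon (ω, z))).toENNReal ∂P ∂(P.map ξ) : ENNReal) : EReal) -
      ((∫⁻ z, ∫⁻ ω, (-(U' (W M.horizon (ω, z)))).toENNReal ∂P ∂(P.map ξ) : ENNReal) : EReal) := by
    have hae : ∀ᵐ ω ∂P, U (M.wealth x B M.horizon ω) = U' (W M.horizon (ω, ξ ω)) := by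
      filter_upwards [hB.2 M.horizon] with ω hω
      rw [hWξ]
      exact (if_pos hω).symm
    rw [expectation, lintegral_congr_ae (hae.mono fun ω h => congrArg EReal.toENNReal h),
      lintegral_congr_ae (hae.mono fun ω h => congrArg (fun v => (-v).toENNReal) h),
      lintegral_comp_prodMk_of_indep hm hξ hindT hpos,
      lintegral_comp_prodMk_of_indep hm hξ hindT hneg]
  rw [hEB]
  have := Measure.isProbabilityMeasure_map (μ := P) hξ.aemeasurable
  refine lintegral_sub_lintegral_le (measurable_lintegral_of_prod hm hpos)
    (measurable_lintegral_of_prod hm hneg) ?_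
  filter_upwards [hgood₁, hgood₂] with z hz₁ hz₂
  have hadm : (fun t ω => R t (ω, z)) ∈ M.admissible K x := by
    refine ⟨M.isStrategy_regularize hgen hH hK h0 hl hDc hD hoD hTD hb hz₁, fun t => ?_⟩
    filter_upwards [(ae_ball_iff hDc).2 hz₂] with ω hω
    change W t (ω, z) ∈ K
    by_cases ht : IsMax t
    · exact hω t (hmax t ht)
    · have := nhdsWithin_inter_Ioi_neBot hD ht
      have hWc : ContinuousWithinAt (fun s => W s (ω, z)) (Ici t) t :=
        continuousWithinAt_pathWealth hl (M.S_continuous ω) (fun t => M.S_pos t ω)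
          (hRdec (ω, z)) (hRc (ω, z)) (M.start_le t)
      refine hK.mem_of_tendsto
        (hWc.mono_left (nhdsWithin_mono t
          ((inter_subset_right (s := D)).trans Ioi_subset_Ici_self))) ?_
      filter_upwards [self_mem_nhdsWithin] with s hs
      exact hω s hs.1
  refine le_trans (le_of_eq ?_) (M.le_bellman U hadm)
  have hae : ∀ᵐ ω ∂P, U' (W M.horizon (ω, z)) =
      U (M.wealth x (fun t ω => R t (ω, z)) M.horizon ω) := by
    filter_upwards [hadm.2 M.horizon] with ω hω
    exact if_pos hω
  rw [expectation, lintegral_congr_ae (hae.mono fun ω h => congrArg EReal.toENNReal h),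
    lintegral_congr_ae (hae.mono fun ω h => congrArg (fun v => (-v).toENNReal) h)]

end MarketModel

end KabanovMarket

end

theorem theorem1 {Ω : Type*} [MeasurableSpace Ω] (P : Measure Ω) [IsProbabilityMeasure P]
    (T : ℝ) (p d : ℕ) [NeZero d]
    (M : KabanovMarket.MarketModel P T p d)
    (hgen : M.IsGenerated) (hH : M.IndependentIncrements)
    (K : ConvexCone ℝ (Fin d → ℝ))
    (hKclosed : IsClosed (K : Set (Fin d → ℝ)))
    (hKproper : (K : Set (Fin d → ℝ)) ∩ {z | -z ∈ K} = {0})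
    (hKpos : {z : Fin d → ℝ | ∀ j, 0 < z j} ⊆ (K : Set (Fin d → ℝ)))
    (U : (Fin d → ℝ) → EReal)
    (hUmeas : Measurable fun z : (K : Set (Fin d → ℝ)) => U z)
    (hUtop : ∀ z ∈ K, U z ≠ ⊤)
    (ξ : Ω → ℝ) (hξ : Measurable ξ)
    (hξunif : P.map ξ = volume.restrict (Set.Icc (0 : ℝ) 1))
    (hξindep : IndepFun (fun ω t => M.Y t ω) ξ P)
    (x : Fin d → ℝ) (hx : x ∈ interior (K : Set (Fin d → ℝ))) :
    M.bellman K U x = (M.enlarge ξ hξ).bellman K U x := by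
  refine le_antisymm (M.bellman_le_bellman_enlarge hξ K U x) ?_
  -- The enlarged model has the same processes, hence the same wealth for a given strategy.
  exact iSup₂_le fun B hB =>
    M.expectation_le_bellman hgen hH hKclosed hKproper hUmeas hξ hξindep hB
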